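/- Let $\xi\in\mathbb R\setminus\{0\}$, $\xi_1=-\tfrac13\xi$, $\xi_2=\xi_3=\tfrac23\xi$, and let $a>0$, $b\in\mathbb R$ and distinct $a_1,a_2,a_3\in\mathbb C$ satisfy $\sum_{k\ne j}\frac{\xi_k}{a_j-a_k}=2\pi i\,\bar a_j(a-ib)$ for $j=1,2,3$ (so that $w_j(t)=a_j\sqrt{2at}\,e^{i\frac b{2a}\log t}$ is a self-similar burst of three free vortices with intensities $\xi_1,\xi_2,\xi_3$). For $T>0$ let $E_T=C([0,T),C^2(\mathbb C,\mathbb C))\cap \mathrm{Lip}([0,T),C(\mathbb C,\mathbb C))$, with $$\|f\|_{E_T}=\sup_{0\le t<T}\big(\|f_t\|_\infty+\|Df_t\|_\infty+\|D^2f_t\|_\infty\big)+\sup_{s\neq t}\frac{\|f_t-f_s\|_\infty}{|t-s|}$$ (real derivatives in space), and $\|f-g\|_\infty=\sup_{0\le t<T}\sup_{p\in\mathbb C}|f(t,p)-g(t,p)|$. Let $\mathcal U_T$ be the set of continuous $(\zeta,\eta,x_2,x_3):(0,T)\to\mathbb R^2\times\mathbb C^2$ such that $\lim_{t\to T}\eta(t)=0$;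 $|\zeta(t)-2at|\le t^{3/2}$ and $|x_2(t)|,|x_3(t)|\le t^{1/2}$ for all $t\in(0,T)$; and $\zeta,\eta,x_2,x_3$ have $\tfrac12$-Hölder seminorm at most $1$ on $(0,T)$. Let $\mathcal X_T$ be the set of curves $(re^{i\theta},x_2,x_3)$ with $r=\sqrt{\zeta}$, $\theta(t)=\eta(t)+\frac b{2a}\log t$, $(\zeta,\eta,x_2,x_3)\in\mathcal U_T$. Let $\Phi(z_1,z_2,z_3)=\big(\frac{z_1}{a_1},\frac{z_2}{z_1}-\frac{a_2}{a_1},\frac{z_3}{z_1}-\frac{a_3}{a_1}\big)$. For $\rho>0$ and $f\in E_T$, a *bursting solution* with field $f$ is a curve $z:(0,T)\to\mathbb C^3$ with $z_j(t)\neq z_k(t)$ for $j\ne k$, solving $$\dot{\bar z}_j=\frac1{2\pi i}\sum_{k\ne j}\frac{\xi_k}{z_j-z_k}+f(t,z_j),\qquad t\in(0,T),\ j=1,2,3,$$ with $\sup_{0<t<T}|z(t)|\le\rho$, and such that $x:=\Phi(\tilde z)\in\mathcal X_T$, where $\tilde z_j(t)=z_j(t)-\overline{f(0,0)}\,t$ (thus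 $\tilde z=z$ if $f(0,0)=0$). Then for every $M>0$ there is a constant $C>0$, depending only on $\xi,a,b,a_1,a_2,a_3,M$, such that for every $\rho>0$ there is $T^*>0$ such that for every $0<T<T^*$, all $f,g\in E_T$ with $\|f\|_{E_T},\|g\|_{E_T}\le M$, and all bursting solutions $z,z'$ with fields $f$ and $g$ respectively, with $x=\Phi(\tilde z)$ and $x'=\Phi(\tilde z')$ (where $\tilde z'_j(t)=z'_j(t)-\overline{g(0,0)}\,t$), $$\sup_{0<t<T,\ j=1,2,3}|z_j(t)-z'_j(t)|\le C\,T^{1/2}\,\|f-g\|_\infty\qquad\text{and}\qquad \sup_{0<t<T}|x(t)-x'(t)|\le C\,T^{1/2}\,\|f-g\|_\infty .$$ -/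

import Mathlib

open Set Filter Topology
open scoped ENNReal ComplexConjugate

namespace VortexBurst

noncomputable section

/-- The space `ℂ³` of positions of three vortices, with its Euclidean norm. -/
abbrev C3 : Type := EuclideanSpace ℂ (Fin 3)

/-- The norm `‖h‖_∞ + ‖Dh‖_∞ + ‖D²h‖_∞` of a function `h : ℂ → ℂ`, with real derivatives;
it takes the value `∞` when one of the suprema is infinite. -/
def c2Norm (h : ℂ → ℂ) : ℝ≥0∞ :=
  ∑ k ∈ Finset.range 3, ⨆ p : ℂ, ‖iteratedFDeriv ℝ k h p‖ₑ

/-- `‖f - g‖_∞`, the supremum over `0 ≤ t < T` and `p ∈ ℂ`. -/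
def supDist (T : ℝ) (f g : ℝ → ℂ → ℂ) : ℝ≥0∞ :=
  ⨆ t ∈ Ico 0 T, ⨆ p : ℂ, ‖f t p - g t p‖ₑ

/-- The Lipschitz seminorm in time on `[0, T)`, with respect to the supremum norm in space. -/
def lipSeminorm (T : ℝ) (f : ℝ → ℂ → ℂ) : ℝ≥0∞ :=
  ⨆ s ∈ Ico 0 T, ⨆ t ∈ Ico 0 T, ⨆ _ : s ≠ t,
    (⨆ p : ℂ, ‖f t p - f s p‖ₑ) / ENNReal.ofReal |t - s|

/-- The norm of `E_T`. -/
def eNorm (T : ℝ) (f : ℝ → ℂ → ℂ) : ℝ≥0∞ :=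
  (⨆ t ∈ Ico 0 T, c2Norm (f t)) + lipSeminorm T f

/-- The space `E_T = C([0,T), C²(ℂ,ℂ)) ∩ Lip([0,T), C(ℂ,ℂ))`; only the values of `f` at the
times in `[0, T)` matter. -/
structure MemE (T : ℝ) (f : ℝ → ℂ → ℂ) : Prop where
  contDiff : ∀ t ∈ Ico 0 T, ContDiff ℝ 2 (f t)
  finite : ∀ t ∈ Ico 0 T, c2Norm (f t) < ⊤
  continuous : ∀ t ∈ Ico 0 T,
    Tendsto (fun s => c2Norm (fun p => f s p - f t p)) (𝓝[Ico 0 T] t) (𝓝 0)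
  lipschitz : lipSeminorm T f < ⊤

/-- The intensities `-ξ/3, 2ξ/3, 2ξ/3` of the three vortices. -/
def intensity (ξ : ℝ) : Fin 3 → ℝ := ![-(1 / 3) * ξ, 2 / 3 * ξ, 2 / 3 * ξ]

/-- `a > 0`, `b` and the three distinct points `α 0, α 1, α 2` are parameters of a self-similar
burst `w_j(t) = α_j √(2at) exp(i (b / 2a) log t)` of three free vortices. -/
structure IsSelfSimilar (ξ a b : ℝ) (α : Fin 3 → ℂ) : Prop where
  pos : 0 < a
  distinct : Function.Injective α
  relation : ∀ j, ∑ k ∈ Finset.univ.erase j, (intensity ξ k : ℂ) / (α j - α k) =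
    2 * Real.pi * Complex.I * conj (α j) * (a - Complex.I * b)

/-- `z` solves on `(0, T)`, without collisions, the equations of three vortices in the external
field `f`. Such a curve is automatically of class `C¹` when `f` is continuous. -/
structure IsSolution (ξ T : ℝ) (f : ℝ → ℂ → ℂ) (z : ℝ → C3) : Prop where
  noCollision : ∀ t ∈ Ioo 0 T, ∀ j k, j ≠ k → z t j ≠ z t k
  equation : ∀ t ∈ Ioo 0 T, ∀ j,
    HasDerivAt (fun s => conj (z s j))
      (1 / (2 * Real.pi * Complex.I) *
          ∑ k ∈ Finset.univ.erase j, (intensity ξ k : ℂ) / (z t j - z t k)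
        + f t (z t j)) t

/-- The change of coordinates
`Φ(z₁, z₂, z₃) = (z₁ / a₁, z₂ / z₁ - a₂ / a₁, z₃ / z₁ - a₃ / a₁)`, used where `z₁ ≠ 0`. -/
def Φ (α : Fin 3 → ℂ) (z : C3) : C3 :=
  !₂[z 0 / α 0, z 1 / z 0 - α 1 / α 0, z 2 / z 0 - α 2 / α 0]

/-- The class `U_T` of curves `(ζ, η, x₂, x₃)` on `(0, T)`. -/
structure MemU (a T : ℝ) (ζ η : ℝ → ℝ) (x₂ x₃ : ℝ → ℂ) : Prop where
  continuous : ContinuousOn ζ (Ioo 0 T) ∧ ContinuousOn η (Ioo 0 T) ∧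
    ContinuousOn x₂ (Ioo 0 T) ∧ ContinuousOn x₃ (Ioo 0 T)
  angle : Tendsto η (𝓝[<] T) (𝓝 0)
  dist_radius : ∀ t ∈ Ioo 0 T, |ζ t - 2 * a * t| ≤ t ^ (3 / 2 : ℝ)
  dist_shape : ∀ t ∈ Ioo 0 T, ‖x₂ t‖ ≤ t ^ (1 / 2 : ℝ) ∧ ‖x₃ t‖ ≤ t ^ (1 / 2 : ℝ)
  holder : HolderOnWith 1 (1 / 2) ζ (Ioo 0 T) ∧ HolderOnWith 1 (1 / 2) η (Ioo 0 T) ∧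
    HolderOnWith 1 (1 / 2) x₂ (Ioo 0 T) ∧ HolderOnWith 1 (1 / 2) x₃ (Ioo 0 T)

/-- The class `X_T` of curves `(r e^{iθ}, x₂, x₃)` on `(0, T)` with `r² = ζ` and
`θ = η + (b / 2a) log t` for some `(ζ, η, x₂, x₃)` in `U_T`. -/
def MemX (a b T : ℝ) (x : ℝ → C3) : Prop :=
  ∃ (ζ η : ℝ → ℝ) (x₂ x₃ : ℝ → ℂ), MemU a T ζ η x₂ x₃ ∧ ∀ t ∈ Ioo 0 T,
    x t = !₂[(Real.sqrt (ζ t) : ℂ) *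
        Complex.exp (((η t + b / (2 * a) * Real.log t : ℝ) : ℂ) * Complex.I), x₂ t, x₃ t]

/-- The curve `z` seen from the frame moving with the velocity of the field at the origin at
time `0`: `z̃_j(t) = z_j(t) - t · conj (f(0,0))`. It is `z` itself when `f(0,0) = 0`; in general
it solves the equations with the field `f(t, p + t · conj (f(0,0))) - f(0,0)`, which vanishes
at `(0,0)`. -/
def comoving (f : ℝ → ℂ → ℂ) (z : ℝ → C3) (t : ℝ) : C3 :=
  WithLp.toLp 2 fun j => z t j - conj (f 0 0) * t

/-- The bursting solutions in the field `f`: solutions on `(0, T)` that stay in the ball of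
radius `ρ` and whose coordinates `Φ`, in the comoving frame, form a curve in `X_T`. -/
structure IsBurst (ξ a b : ℝ) (α : Fin 3 → ℂ) (ρ T : ℝ) (f : ℝ → ℂ → ℂ) (z : ℝ → C3) :
    Prop where
  solution : IsSolution ξ T f z
  bound : ∀ t ∈ Ioo 0 T, ‖z t‖ ≤ ρ
  mem : MemX a b T fun t => Φ α (comoving f z t)

end

end VortexBurst

/-! For the intensities -ξ/3, 2ξ/3, 2ξ/3 the sum of ξ_j ξ_k over pairs vanishes. Free vortices
therefore conserve the center of vorticity, the moment of inertia and a scale-invariant energy, the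
modulus of a cross ratio. After division by powers of the first position, these become functions
`shapeInv` of the shape (z₁/z₀, z₂/z₀) alone. They have four real components, as many as the shape,
and their differential at the shape of the burst is injective because a > 0
(`fderiv_shapeInv_injective`). Near the burst the invariants thus control the shape.

In an external field the invariants move only through the forces, and all the quantities integrated
from time 0 have known limits there. As |z₀| is of order √t, the center is O(t), the moment O(t√t)
and the energy deviation O(√t); after normalization each is O(√t). Applied to two bursts whose data
differ by N and whose fields differ by D, the same count bounds the difference of shapes by C√t(N +
D) (`isBigO_relShape_sub`). The shape determines the derivative of |z₀|² up to the force, so the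
squared radii differ by C t√t(N + D). The angles are integrated backwards from T, where both
deviations vanish: their rate differs by C(N + D)/√t, which is integrable and gives C√T(N + D).

Hence a bound N on the difference of the data improves to C√T(N + D) (`exists_isPair_contract`).
Applied to the least admissible N with C√T ≤ 1/2, this gives N ≤ 2C√T D (`exists_isPair_bound`). A
general field is first reduced to one vanishing at (0,0) in the comoving frame, where the forces
stay bounded and Lipschitz (`exists_burst_bound`). -/

namespace VortexBurst

open Asymptotics

/-! ### Calculus of sizes and differences for pairs of families -/

/-- Two families `X`, `X'` are of size `O(s)` and differ by `O(s * e)` along the filter `l`. -/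
structure Near {ι E : Type*} [NormedAddCommGroup E] (l : Filter ι) (s e : ι → ℝ)
    (X X' : ι → E) : Prop where
  left : X =O[l] s
  right : X' =O[l] s
  diff : (fun i => X i - X' i) =O[l] fun i => s i * e i

namespace Near

variable {ι E : Type*} [NormedAddCommGroup E] {l : Filter ι} {s s₁ s₂ e : ι → ℝ}

theorem add {X X' Y Y' : ι → E} (hX : Near l s e X X') (hY : Near l s e Y Y') :
    Near l s e (fun i => X i + Y i) (fun i => X' i + Y' i) where
  left := hX.left.add hY.left
  right := hX.right.add hY.right
  diff := (hX.diff.add hY.diff).congr_left fun i => by abel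

theorem neg {X X' : ι → E} (hX : Near l s e X X') :
    Near l s e (fun i => -X i) (fun i => -X' i) where
  left := hX.left.neg_left
  right := hX.right.neg_left
  diff := hX.diff.neg_left.congr_left fun i => by abel

theorem sub {X X' Y Y' : ι → E} (hX : Near l s e X X') (hY : Near l s e Y Y') :
    Near l s e (fun i => X i - Y i) (fun i => X' i - Y' i) := by
  simpa only [sub_eq_add_neg] using hX.add hY.neg

theorem mul {𝕜 : Type*} [NormedField 𝕜] {X X' Y Y' : ι → 𝕜} (hX : Near l s₁ e X X')
    (hY : Near l s₂ e Y Y') :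
    Near l (fun i => s₁ i * s₂ i) e (fun i => X i * Y i) (fun i => X' i * Y' i) where
  left := hX.left.mul hY.left
  right := hX.right.mul hY.right
  diff := (((hX.diff.mul hY.left).congr_right fun i => by ring).add
    ((hX.right.mul hY.diff).congr_right fun i => by ring)).congr_left fun i => by ring

theorem const_mul {𝕜 : Type*} [NormedField 𝕜] {X X' : ι → 𝕜} (c : 𝕜) (hX : Near l s e X X') :
    Near l s e (fun i => c * X i) (fun i => c * X' i) where
  left := hX.left.const_mul_left c
  right := hX.right.const_mul_left c
  diff := (hX.diff.const_mul_left c).congr_left fun i => by ring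

/-- The identity 1/X - 1/X' = (X' - X)/(XX') preserves the relative error e, provided lower bounds
of order s hold for both families; these are the two bounds on the inverses. -/
theorem inv {𝕜 : Type*} [NormedField 𝕜] {X X' : ι → 𝕜} (hX : Near l s e X X')
    (h : ∀ᶠ i in l, X i ≠ 0) (h' : ∀ᶠ i in l, X' i ≠ 0)
    (hl : (fun i => (X i)⁻¹) =O[l] fun i => (s i)⁻¹)
    (hr : (fun i => (X' i)⁻¹) =O[l] fun i => (s i)⁻¹) :
    Near l (fun i => (s i)⁻¹) e (fun i => (X i)⁻¹) (fun i => (X' i)⁻¹) where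
  left := hl
  right := hr
  diff := by
    have key := (hl.mul hX.diff.neg_left).mul hr
    refine key.congr' ?_ ?_
    · filter_upwards [h, h'] with i hi hi'
      field_simp
      ring
    · refine Eventually.of_forall fun i => ?_
      by_cases hs : s i = 0
      · simp [hs]
      · simp only
        field_simp

theorem comp_norm_le {F : Type*} [NormedAddCommGroup F] {X X' : ι → E} (hX : Near l s e X X')
    {φ : E → F} (h0 : ∀ x, ‖φ x‖ ≤ ‖x‖) (h1 : ∀ x y, ‖φ x - φ y‖ ≤ ‖x - y‖) :
    Near l s e (fun i => φ (X i)) (fun i => φ (X' i)) where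
  left := (isBigO_of_le l fun _ => h0 _).trans hX.left
  right := (isBigO_of_le l fun _ => h0 _).trans hX.right
  diff := (isBigO_of_le l fun _ => h1 _ _).trans hX.diff

theorem star {X X' : ι → ℂ} (hX : Near l s e X X') :
    Near l s e (fun i => conj (X i)) (fun i => conj (X' i)) :=
  hX.comp_norm_le (φ := fun x => conj x) (fun x => by simp)
    fun x y => by rw [← map_sub, RCLike.norm_conj]

theorem re {X X' : ι → ℂ} (hX : Near l s e X X') :
    Near l s e (fun i => (X i).re) (fun i => (X' i).re) :=
  hX.comp_norm_le (φ := Complex.re) (fun x => Complex.abs_re_le_norm x)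
    fun x y => by rw [← Complex.sub_re]; exact Complex.abs_re_le_norm _

theorem norm {X X' : ι → E} (hX : Near l s e X X') :
    Near l s e (fun i => ‖X i‖) (fun i => ‖X' i‖) :=
  hX.comp_norm_le (φ := fun x => ‖x‖) (fun x => by simp)
    fun x y => abs_norm_sub_norm_le x y

theorem ofReal {X X' : ι → ℝ} (hX : Near l s e X X') :
    Near l s e (fun i => (X i : ℂ)) (fun i => (X' i : ℂ)) :=
  hX.comp_norm_le (φ := fun x : ℝ => (x : ℂ)) (fun x => by simp)
    fun x y => by rw [← Complex.ofReal_sub, Complex.norm_real]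

theorem congr_scale {X X' : ι → E} (hX : Near l s e X X') (h : s =ᶠ[l] s₁) :
    Near l s₁ e X X' where
  left := hX.left.congr' .rfl h
  right := hX.right.congr' .rfl h
  diff := hX.diff.congr' .rfl (h.mono fun i hi => by simp [hi])

theorem congr {X X' Y Y' : ι → E} (hX : Near l s e X X') (h : X =ᶠ[l] Y) (h' : X' =ᶠ[l] Y') :
    Near l s e Y Y' where
  left := hX.left.congr' h .rfl
  right := hX.right.congr' h' .rfl
  diff := hX.diff.congr' (h.sub h') .rfl

theorem mono {X X' : ι → E} (hX : Near l s e X X') (h : s =O[l] s₁) : Near l s₁ e X X' where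
  left := hX.left.trans h
  right := hX.right.trans h
  diff := hX.diff.trans (h.mul (isBigO_refl e l))

/-- Replacing the relative error by a smaller one. -/
theorem of_diff {e₁ : ι → ℝ} {X X' : ι → E} (hX : Near l s e X X')
    (h : (fun i => X i - X' i) =O[l] fun i => s i * e₁ i) : Near l s e₁ X X' :=
  ⟨hX.left, hX.right, h⟩

end Near

/-! ### Integration of derivative bounds in time -/

theorem norm_sub_le_of_norm_deriv_le {E : Type*} [NormedAddCommGroup E] [NormedSpace ℝ E]
    {T : ℝ} {X X' : ℝ → E} {B b : ℝ → ℝ}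
    (hX : ∀ t ∈ Ioo 0 T, HasDerivAt X (X' t) t) (hB : ∀ t ∈ Ioo 0 T, HasDerivAt B (b t) t)
    (hle : ∀ t ∈ Ioo 0 T, ‖X' t‖ ≤ b t) {s t : ℝ} (hs : 0 < s) (hst : s ≤ t) (ht : t < T) :
    ‖X t - X s‖ ≤ B t - B s := by
  have hsub : ∀ x ∈ Icc s t, x ∈ Ioo 0 T := fun x hx => ⟨hs.trans_le hx.1, hx.2.trans_lt ht⟩
  refine image_norm_le_of_norm_deriv_right_le_deriv_boundary' (f := fun x => X x - X s) (f' := X')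
    (a := s) (b := t) (B := fun x => B x - B s) (B' := b)
    (fun x hx => ((hX x (hsub x hx)).sub_const _).continuousAt.continuousWithinAt)
    (fun x hx => ((hX x (hsub x ⟨hx.1, hx.2.le⟩)).sub_const _).hasDerivWithinAt) (by simp)
    (fun x hx => ?_) (fun x hx => ?_) (fun x hx => hle x (hsub x ⟨hx.1, hx.2.le⟩))
    (right_mem_Icc.2 hst)
  · exact ((hB x (hsub x hx)).sub_const _).continuousAt.continuousWithinAt
  · exact ((hB x (hsub x ⟨hx.1, hx.2.le⟩)).sub_const _).hasDerivWithinAt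

/-- A differentiable function that tends to `0` at `0` is bounded by any function with the same
property whose derivative dominates. -/
theorem norm_le_of_norm_deriv_le {E : Type*} [NormedAddCommGroup E] [NormedSpace ℝ E]
    {T : ℝ} {X X' : ℝ → E} {B b : ℝ → ℝ}
    (hX : ∀ t ∈ Ioo 0 T, HasDerivAt X (X' t) t) (hB : ∀ t ∈ Ioo 0 T, HasDerivAt B (b t) t)
    (hle : ∀ t ∈ Ioo 0 T, ‖X' t‖ ≤ b t) (hX0 : Tendsto X (𝓝[>] 0) (𝓝 0))
    (hB0 : Tendsto B (𝓝[>] 0) (𝓝 0)) {t : ℝ} (ht : t ∈ Ioo 0 T) : ‖X t‖ ≤ B t := by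
  have key : ∀ᶠ s in 𝓝[>] (0 : ℝ), ‖X t - X s‖ ≤ B t - B s := by
    filter_upwards [Ioo_mem_nhdsGT ht.1] with s hs
    exact norm_sub_le_of_norm_deriv_le hX hB hle hs.1 hs.2.le ht.2
  simpa using le_of_tendsto_of_tendsto (tendsto_const_nhds.sub hX0).norm
    (tendsto_const_nhds.sub hB0) key

/-- The big-O is over a principal filter, so its constant is uniform in the datum d. The weight w
depends on d only and passes through the integration in time. -/
theorem isBigO_of_deriv {𝒟 E : Type*} [NormedAddCommGroup E] [NormedSpace ℝ E] {T : 𝒟 → ℝ}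
    {V : Set 𝒟} {X X' : 𝒟 × ℝ → E} {w : 𝒟 → ℝ} {B b : ℝ → ℝ}
    (hX : ∀ d ∈ V, ∀ t ∈ Ioo 0 (T d), HasDerivAt (fun t => X (d, t)) (X' (d, t)) t)
    (hX0 : ∀ d ∈ V, 0 < T d → Tendsto (fun t => X (d, t)) (𝓝[>] 0) (𝓝 0))
    (hw : ∀ d ∈ V, 0 ≤ w d) (hb : ∀ t, 0 < t → 0 ≤ b t)
    (hB : ∀ t, 0 < t → HasDerivAt B (b t) t) (hB0 : Tendsto B (𝓝[>] 0) (𝓝 0))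
    (h : X' =O[𝓟 {p | p.1 ∈ V ∧ p.2 ∈ Ioo 0 (T p.1)}] fun p => b p.2 * w p.1) :
    X =O[𝓟 {p | p.1 ∈ V ∧ p.2 ∈ Ioo 0 (T p.1)}] fun p => B p.2 * w p.1 := by
  obtain ⟨c, hc⟩ := isBigO_principal.1 h
  -- The constant extracted from a big-O may be negative; the comparison function needs a
  -- nonnegative one.
  refine isBigO_principal.2 ⟨max c 0, ?_⟩
  rintro ⟨d, t⟩ ⟨hd, ht⟩
  refine (norm_le_of_norm_deriv_le (B := fun t => max c 0 * (B t * w d))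
    (b := fun t => max c 0 * (b t * w d)) (hX d hd)
    (fun t ht => ((hB t ht.1).mul_const _).const_mul _) (fun t ht => ?_) (hX0 d hd (ht.1.trans ht.2)) ?_ ht).trans ?_
  · refine (hc (d, t) ⟨hd, ht⟩).trans ?_
    rw [Real.norm_of_nonneg (mul_nonneg (hb t ht.1) (hw d hd))]
    exact mul_le_mul_of_nonneg_right (le_max_left _ _) (mul_nonneg (hb t ht.1) (hw d hd))
  · simpa using (hB0.mul_const (w d)).const_mul (max c 0)
  · exact mul_le_mul_of_nonneg_left (Real.le_norm_self _) (le_max_right _ _)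

/-- Integration from `0` of a pair of families. -/
theorem Near.of_deriv {𝒟 E : Type*} [NormedAddCommGroup E] [NormedSpace ℝ E] {T : 𝒟 → ℝ}
    {V : Set 𝒟} {X X' Y Y' : 𝒟 × ℝ → E} {w : 𝒟 → ℝ} {B b : ℝ → ℝ}
    (hX : ∀ d ∈ V, ∀ t ∈ Ioo 0 (T d), HasDerivAt (fun t => X (d, t)) (X' (d, t)) t)
    (hY : ∀ d ∈ V, ∀ t ∈ Ioo 0 (T d), HasDerivAt (fun t => Y (d, t)) (Y' (d, t)) t)
    (hX0 : ∀ d ∈ V, 0 < T d → Tendsto (fun t => X (d, t)) (𝓝[>] 0) (𝓝 0))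
    (hY0 : ∀ d ∈ V, 0 < T d → Tendsto (fun t => Y (d, t)) (𝓝[>] 0) (𝓝 0))
    (hw : ∀ d ∈ V, 0 ≤ w d) (hb : ∀ t, 0 < t → 0 ≤ b t)
    (hB : ∀ t, 0 < t → HasDerivAt B (b t) t) (hB0 : Tendsto B (𝓝[>] 0) (𝓝 0))
    (h : Near (𝓟 {p | p.1 ∈ V ∧ p.2 ∈ Ioo 0 (T p.1)}) (fun p => b p.2) (fun p => w p.1) X' Y') :
    Near (𝓟 {p | p.1 ∈ V ∧ p.2 ∈ Ioo 0 (T p.1)}) (fun p => B p.2) (fun p => w p.1) X Y where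
  left := by
    simpa using isBigO_of_deriv (w := fun _ => 1) hX hX0 (fun _ _ => zero_le_one) hb hB hB0
      (by simpa using h.left)
  right := by
    simpa using isBigO_of_deriv (w := fun _ => 1) hY hY0 (fun _ _ => zero_le_one) hb hB hB0
      (by simpa using h.right)
  diff := isBigO_of_deriv (fun d hd t ht => (hX d hd t ht).sub (hY d hd t ht))
    (fun d hd hT => by simpa using (hX0 d hd hT).sub (hY0 d hd hT)) hw hb hB hB0 h.diff

/-! ### Algebra of three free vortices and of the self-similar burst -/

/-- The factor `ξ / (6πi)`. -/
noncomputable def kap (ξ : ℝ) : ℂ := ξ / (6 * Real.pi * Complex.I)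

/-- The velocities, up to the factor `kap ξ`, of free vortices at `1`, `y.1`, `y.2`. -/
noncomputable def shapeVel (y : ℂ × ℂ) : Fin 3 → ℂ :=
  ![2 / (1 - y.1) + 2 / (1 - y.2), 1 / (1 - y.1) + 2 / (y.1 - y.2), 1 / (1 - y.2) - 2 / (y.1 - y.2)]

/-- The ratio of the products of distances, whose modulus is conserved by free vortices. -/
noncomputable def crossRatio (y : ℂ × ℂ) : ℂ := (1 - y.1) * (1 - y.2) / (y.1 - y.2) ^ 2

/-- The normalized center of vorticity, moment of inertia and energy of a triangle. -/
noncomputable def shapeInv (y : ℂ × ℂ) : ℂ × ℝ × ℝ :=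
  (-1 + 2 * y.1 + 2 * y.2, -1 + 2 * ‖y.1‖ ^ 2 + 2 * ‖y.2‖ ^ 2, ‖crossRatio y‖ ^ 2)

/-- The points `1`, `y.1`, `y.2` are distinct. -/
structure Distinct (y : ℂ × ℂ) : Prop where
  ne_fst : 1 - y.1 ≠ 0
  ne_snd : 1 - y.2 ≠ 0
  ne : y.1 - y.2 ≠ 0

theorem conj_kap (ξ : ℝ) : conj (kap ξ) = -kap ξ := by
  simp [kap, neg_div', div_neg, Complex.conj_ofNat]

/-- The pair interactions are antisymmetric; this is conservation of the center of vorticity. -/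
theorem shapeVel_sum {y : ℂ × ℂ} :
    -shapeVel y 0 + 2 * shapeVel y 1 + 2 * shapeVel y 2 = 0 := by
  simp [shapeVel]
  ring

/-- The left side is a multiple of the virial, the sum of ξ_j ξ_k over pairs, which vanishes for
these intensities. It yields conservation of the moment and scale invariance of the energy. -/
theorem shapeVel_moment {y : ℂ × ℂ} (hy : Distinct y) :
    -shapeVel y 0 + 2 * y.1 * shapeVel y 1 + 2 * y.2 * shapeVel y 2 = 0 := by
  obtain ⟨h1, h2, h3⟩ := hy
  simp [shapeVel]
  field_simp
  ring

/-- The interaction is homogeneous of degree -1, so z₀ can be scaled out, leaving a function of the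
shape. -/
theorem velocity_eq_kap (ξ : ℝ) {z : Fin 3 → ℂ} (hz : Function.Injective z) (h0 : z 0 ≠ 0)
    (j : Fin 3) :
    1 / (2 * Real.pi * Complex.I) * ∑ k ∈ Finset.univ.erase j, (intensity ξ k : ℂ) / (z j - z k) =
      kap ξ * shapeVel (z 1 / z 0, z 2 / z 0) j / z 0 := by
  have hpi : (Real.pi : ℂ) ≠ 0 := by exact_mod_cast Real.pi_ne_zero
  have h01 : z 0 - z 1 ≠ 0 := sub_ne_zero.2 (hz.ne (by decide))
  have h02 : z 0 - z 2 ≠ 0 := sub_ne_zero.2 (hz.ne (by decide))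
  have h12 : z 1 - z 2 ≠ 0 := sub_ne_zero.2 (hz.ne (by decide))
  have e1 : 1 - z 1 / z 0 = (z 0 - z 1) / z 0 := by field_simp
  have e2 : 1 - z 2 / z 0 = (z 0 - z 2) / z 0 := by field_simp
  have e3 : z 1 / z 0 - z 2 / z 0 = (z 1 - z 2) / z 0 := by field_simp
  rw [Finset.sum_erase _ (by simp), Fin.sum_univ_three]
  have e4 : z 1 - z 0 = -(z 0 - z 1) := by ring
  have e5 : z 2 - z 0 = -(z 0 - z 2) := by ring
  have e6 : z 2 - z 1 = -(z 1 - z 2) := by ring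
  fin_cases j <;>
    simp only [intensity, shapeVel, kap, Fin.zero_eta, Fin.mk_one, Fin.reduceFinMk,
      Matrix.cons_val, sub_self, div_zero]
  · rw [e1, e2]
    push_cast
    field_simp
    ring
  · rw [e1, e3, e4]
    push_cast
    field_simp
    ring
  · rw [e2, e3, e5, e6]
    push_cast
    field_simp
    ring

namespace IsSelfSimilar

variable {ξ a b : ℝ} {α : Fin 3 → ℂ}

theorem rate_ne_zero (hα : IsSelfSimilar ξ a b α) : (a - Complex.I * b : ℂ) ≠ 0 := fun h => by
  have := congrArg Complex.re h
  simp at this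
  exact hα.pos.ne' this

theorem velocity (hα : IsSelfSimilar ξ a b α) (j : Fin 3) :
    1 / (2 * Real.pi * Complex.I) * ∑ k ∈ Finset.univ.erase j, (intensity ξ k : ℂ) / (α j - α k) =
      conj (α j) * (a - Complex.I * b) := by
  have hpi : (Real.pi : ℂ) ≠ 0 := by exact_mod_cast Real.pi_ne_zero
  rw [hα.relation j]
  field_simp

/-- If the first vortex were at the origin, its relation would force α₂ = -α₁; then the
contributions -ξ/3 and (2ξ/3)/2 cancel in the velocity of the second vortex, which a burst cannot
have at rest. -/
theorem ne_zero (hα : IsSelfSimilar ξ a b α) (hξ : ξ ≠ 0) : α 0 ≠ 0 := by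
  intro h0
  have h01 : α 1 ≠ 0 := fun h => absurd (hα.distinct (h.trans h0.symm)) (by decide)
  have h02 : α 2 ≠ 0 := fun h => absurd (hα.distinct (h.trans h0.symm)) (by decide)
  have h12 : α 1 - α 2 ≠ 0 := sub_ne_zero.2 (hα.distinct.ne (by decide))
  have hξ' : (ξ : ℂ) ≠ 0 := by exact_mod_cast hξ
  have hpi : (Real.pi : ℂ) ≠ 0 := by exact_mod_cast Real.pi_ne_zero
  have r0 := hα.velocity 0
  have r1 := hα.velocity 1
  rw [Finset.sum_erase _ (by simp), Fin.sum_univ_three] at r0 r1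
  simp only [intensity, Matrix.cons_val, h0] at r0 r1
  have hs : α 1 + α 2 = 0 := by
    simp only [map_zero, zero_mul, sub_self, div_zero] at r0
    field_simp at r0
    push_cast at r0
    have h3 : (ξ : ℂ) * (α 1 + α 2) = 0 := by linear_combination (-3 / 2 : ℂ) * r0
    simpa [hξ'] using h3
  have h2 : α 2 = -α 1 := by linear_combination hs
  have h3 : conj (α 1) * (a - Complex.I * b) = 0 := by
    rw [← r1, h2, sub_zero, sub_neg_eq_add, ← two_mul]
    push_cast
    field_simp
    simp
  simp [hα.rate_ne_zero, h01] at h3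

/-- The shape of the self-similar burst. -/
noncomputable def _root_.VortexBurst.shape (α : Fin 3 → ℂ) : ℂ × ℂ := (α 1 / α 0, α 2 / α 0)

theorem distinct_shape (hα : IsSelfSimilar ξ a b α) (hξ : ξ ≠ 0) : Distinct (shape α) := by
  have h0 := hα.ne_zero hξ
  have h01 : α 0 - α 1 ≠ 0 := sub_ne_zero.2 (hα.distinct.ne (by decide))
  have h02 : α 0 - α 2 ≠ 0 := sub_ne_zero.2 (hα.distinct.ne (by decide))
  have h12 : α 1 - α 2 ≠ 0 := sub_ne_zero.2 (hα.distinct.ne (by decide))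
  refine ⟨?_, ?_, ?_⟩ <;> simp only [shape]
  · rw [one_sub_div h0]; exact div_ne_zero h01 h0
  · rw [one_sub_div h0]; exact div_ne_zero h02 h0
  · rw [← sub_div]; exact div_ne_zero h12 h0

theorem kap_mul_shapeVel (hα : IsSelfSimilar ξ a b α) (hξ : ξ ≠ 0) (j : Fin 3) :
    kap ξ * shapeVel (shape α) j = α 0 * conj (α j) * (a - Complex.I * b) := by
  have h0 := hα.ne_zero hξ
  have h := (velocity_eq_kap ξ hα.distinct h0 j).symm.trans (hα.velocity j)
  rw [div_eq_iff h0] at h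
  rw [shape, h]
  ring

theorem center (hα : IsSelfSimilar ξ a b α) (hξ : ξ ≠ 0) :
    -1 + 2 * (shape α).1 + 2 * (shape α).2 = 0 := by
  have h0 := hα.ne_zero hξ
  have h : α 0 * (a - Complex.I * b) * conj (-α 0 + 2 * α 1 + 2 * α 2) = 0 := by
    have := congrArg (kap ξ * ·) (shapeVel_sum (y := shape α))
    simp only [mul_zero] at this
    simp only [map_add, map_mul, map_neg, Complex.conj_ofNat]
    linear_combination this - hα.kap_mul_shapeVel hξ 0 * (-1) - 2 * hα.kap_mul_shapeVel hξ 1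
      - 2 * hα.kap_mul_shapeVel hξ 2
  simp only [mul_eq_zero, h0, hα.rate_ne_zero, map_eq_zero, false_or] at h
  simp only [shape]
  field_simp
  linear_combination h

theorem moment (hα : IsSelfSimilar ξ a b α) (hξ : ξ ≠ 0) :
    -1 + 2 * ‖(shape α).1‖ ^ 2 + 2 * ‖(shape α).2‖ ^ 2 = 0 := by
  have h0 := hα.ne_zero hξ
  have h1 : conj (α 0) ≠ 0 := by simpa using h0
  have h : (α 0 * conj (α 0) * (a - Complex.I * b)) * (-1 + 2 * ((shape α).1 * conj (shape α).1)
      + 2 * ((shape α).2 * conj (shape α).2)) = 0 := by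
    have := congrArg (kap ξ * ·) (shapeVel_moment (hα.distinct_shape hξ))
    simp only [mul_zero] at this
    have e1 : conj (α 0) * conj (shape α).1 = conj (α 1) := by
      rw [← map_mul, shape, mul_div_cancel₀ _ h0]
    have e2 : conj (α 0) * conj (shape α).2 = conj (α 2) := by
      rw [← map_mul, shape, mul_div_cancel₀ _ h0]
    linear_combination this - hα.kap_mul_shapeVel hξ 0 * (-1)
      - 2 * (shape α).1 * hα.kap_mul_shapeVel hξ 1 - 2 * (shape α).2 * hα.kap_mul_shapeVel hξ 2
      + 2 * (α 0 * (a - Complex.I * b)) * (shape α).1 * e1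
      + 2 * (α 0 * (a - Complex.I * b)) * (shape α).2 * e2
  have h2 := (mul_eq_zero.1 h).resolve_left (mul_ne_zero (mul_ne_zero h0 h1) hα.rate_ne_zero)
  simp only [Complex.mul_conj'] at h2
  exact_mod_cast h2

end IsSelfSimilar

/-! ### Regularity and nondegeneracy of the invariants -/

theorem contDiffAt_shapeVel {y : ℂ × ℂ} (hy : Distinct y) : ContDiffAt ℝ 1 shapeVel y := by
  obtain ⟨h1, h2, h3⟩ := hy
  rw [contDiffAt_pi]
  intro j
  fin_cases j <;> simp only [shapeVel, Fin.zero_eta, Fin.mk_one, Fin.reduceFinMk, Matrix.cons_val]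
    <;> simp only [div_eq_mul_inv] <;> fun_prop (disch := assumption)

theorem contDiffAt_crossRatio {y : ℂ × ℂ} (hy : Distinct y) : ContDiffAt ℝ 1 crossRatio y := by
  obtain ⟨h1, h2, h3⟩ := hy
  have h4 : (y.1 - y.2) ^ 2 ≠ 0 := pow_ne_zero _ h3
  unfold crossRatio
  simp only [div_eq_mul_inv]
  fun_prop (disch := assumption)

theorem contDiffAt_shapeInv {y : ℂ × ℂ} (hy : Distinct y) : ContDiffAt ℝ 1 shapeInv y := by
  have h := contDiffAt_crossRatio hy
  unfold shapeInv
  have h1 : ContDiffAt ℝ 1 (fun y : ℂ × ℂ => ‖y.1‖ ^ 2) y := contDiffAt_fst.norm_sq ℝ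
  have h2 : ContDiffAt ℝ 1 (fun y : ℂ × ℂ => ‖y.2‖ ^ 2) y := contDiffAt_snd.norm_sq ℝ
  have h3 : ContDiffAt ℝ 1 (fun y : ℂ × ℂ => ‖crossRatio y‖ ^ 2) y := h.norm_sq ℝ
  fun_prop

/-- The derivative of `crossRatio` along a curve. -/
theorem hasDerivAt_crossRatio {u v : ℝ → ℂ} {u' v' : ℂ} {t : ℝ} (hu : HasDerivAt u u' t)
    (hv : HasDerivAt v v' t) (hy : Distinct (u t, v t)) :
    HasDerivAt (fun t => crossRatio (u t, v t)) (-(crossRatio (u t, v t) *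
      (shapeVel (u t, v t) 1 * u' + shapeVel (u t, v t) 2 * v'))) t := by
  obtain ⟨h1, h2, h3⟩ := hy
  simp only at h1 h2 h3
  have := (((hu.const_sub 1).mul (hv.const_sub 1)).div ((hu.sub hv).pow 2) (pow_ne_zero 2 h3))
  refine this.congr_deriv ?_
  simp [shapeVel, crossRatio]
  field_simp
  ring

theorem hasDerivAt_norm_sq {w : ℝ → ℂ} {w' : ℂ} {t : ℝ} (hw : HasDerivAt w w' t) :
    HasDerivAt (fun t => ‖w t‖ ^ 2) (2 * (conj (w t) * w').re) t := by
  have := hw.norm_sq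
  rwa [Complex.inner, mul_comm w'] at this

/-- Write (u, v) for the shape and let h be in the kernel. The center gives h₂ = -h₁, the moment
makes S = conj(u - v) h₁ purely imaginary, and the energy makes w = (G₁ - G₂) h₁ purely imaginary,
with G = `shapeVel`. Self-similarity links them by κ w = |α₀|² S (a - ib) with κ = `kap ξ`, also
imaginary; the imaginary part forces a · Im S = 0. -/
theorem fderiv_shapeInv_injective {ξ a b : ℝ} {α : Fin 3 → ℂ} (hα : IsSelfSimilar ξ a b α)
    (hξ : ξ ≠ 0) {h : ℂ × ℂ} (hh : fderiv ℝ shapeInv (shape α) h = 0) : h = 0 := by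
  have hd := hα.distinct_shape hξ
  have hc := (contDiffAt_shapeInv hd).differentiableAt one_ne_zero
  have hl : HasDerivAt (fun s : ℝ => shape α + s • h) h 0 := by
    simpa using ((hasDerivAt_id (0 : ℝ)).smul_const h).const_add (shape α)
  have hcomp : HasDerivAt (fun s : ℝ => shapeInv (shape α + s • h)) 0 0 := by
    have h1 : HasFDerivAt shapeInv (fderiv ℝ shapeInv (shape α)) (shape α + (0 : ℝ) • h) := by
      simpa using hc.hasFDerivAt
    have := h1.comp_hasDerivAt (0 : ℝ) hl
    rwa [hh] at this
  have hu := (hasFDerivAt_fst (𝕜 := ℝ) (p := shape α + (0 : ℝ) • h)).comp_hasDerivAt (0 : ℝ) hl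
  have hv := (hasFDerivAt_snd (𝕜 := ℝ) (p := shape α + (0 : ℝ) • h)).comp_hasDerivAt (0 : ℝ) hl
  set u : ℝ → ℂ := fun s => (shape α + s • h).1 with hu_def
  set v : ℝ → ℂ := fun s => (shape α + s • h).2 with hv_def
  replace hu : HasDerivAt u h.1 0 := hu
  replace hv : HasDerivAt v h.2 0 := hv
  have hu0 : u 0 = (shape α).1 := by simp [hu_def]
  have hv0 : v 0 = (shape α).2 := by simp [hv_def]
  have huv : (u 0, v 0) = shape α := by rw [hu0, hv0]
  have c1 := (hasFDerivAt_fst (𝕜 := ℝ)).comp_hasDerivAt (0 : ℝ) hcomp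
  have c2 := (hasFDerivAt_snd (𝕜 := ℝ)).comp_hasDerivAt (0 : ℝ) hcomp
  have c3 := (hasFDerivAt_fst (𝕜 := ℝ)).comp_hasDerivAt (0 : ℝ) c2
  have c4 := (hasFDerivAt_snd (𝕜 := ℝ)).comp_hasDerivAt (0 : ℝ) c2
  replace c1 : HasDerivAt (fun s => -1 + 2 * u s + 2 * v s) 0 0 := c1
  replace c3 : HasDerivAt (fun s => -1 + 2 * ‖u s‖ ^ 2 + 2 * ‖v s‖ ^ 2) 0 0 := c3
  replace c4 : HasDerivAt (fun s => ‖crossRatio (u s, v s)‖ ^ 2) 0 0 := c4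
  have e1 := c1.unique (((hu.const_mul 2).const_add (-1)).add (hv.const_mul 2))
  have e3 := c3.unique ((((hasDerivAt_norm_sq hu).const_mul 2).const_add (-1)).add
    ((hasDerivAt_norm_sq hv).const_mul 2))
  have e4 := c4.unique (hasDerivAt_norm_sq (hasDerivAt_crossRatio hu hv (huv ▸ hd)))
  rw [huv] at e4
  have h2 : h.2 = -h.1 := by linear_combination -e1 / 2
  rw [h2, hu0, hv0] at e3
  rw [h2] at e4
  set S : ℂ := conj ((shape α).1 - (shape α).2) * h.1 with hS
  set w : ℂ := (shapeVel (shape α) 1 - shapeVel (shape α) 2) * h.1 with hw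
  have hS0 : S.re = 0 := by
    have : S = conj (shape α).1 * h.1 + conj (shape α).2 * -h.1 := by rw [hS, map_sub]; ring
    rw [this, Complex.add_re]
    linarith
  have hw0 : w.re = 0 := by
    have h3 : conj (crossRatio (shape α)) * -(crossRatio (shape α) *
        (shapeVel (shape α) 1 * h.1 + shapeVel (shape α) 2 * -h.1)) =
        ((-‖crossRatio (shape α)‖ ^ 2 : ℝ) : ℂ) * w := by
      push_cast
      rw [← Complex.mul_conj', hw]
      ring
    rw [h3, Complex.re_ofReal_mul] at e4
    have h4 : crossRatio (shape α) ≠ 0 :=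
      div_ne_zero (mul_ne_zero hd.ne_fst hd.ne_snd) (pow_ne_zero 2 hd.ne)
    have h5 : ‖crossRatio (shape α)‖ ^ 2 ≠ 0 := by simpa using h4
    have h6 : ‖crossRatio (shape α)‖ ^ 2 * w.re = 0 := by linarith
    exact (mul_eq_zero.1 h6).resolve_left h5
  have h0 := hα.ne_zero hξ
  have hk : kap ξ * w = ((‖α 0‖ ^ 2 : ℝ) : ℂ) * (S * (a - Complex.I * b)) := by
    have e1 : conj (α 0) * conj (shape α).1 = conj (α 1) := by
      rw [← map_mul, shape, mul_div_cancel₀ _ h0]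
    have e2 : conj (α 0) * conj (shape α).2 = conj (α 2) := by
      rw [← map_mul, shape, mul_div_cancel₀ _ h0]
    push_cast
    rw [← Complex.mul_conj', hw, hS, map_sub]
    linear_combination h.1 * (hα.kap_mul_shapeVel hξ 1 - hα.kap_mul_shapeVel hξ 2)
      - α 0 * (a - Complex.I * b) * h.1 * (e1 - e2)
  have hkre : (kap ξ).re = 0 := by
    have := congrArg Complex.re (conj_kap ξ)
    simp only [Complex.conj_re, Complex.neg_re] at this
    linarith
  -- A product of two imaginary numbers is real, so the left side drops out and only |α₀|² a Im S
  -- remains.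
  have him := congrArg Complex.im hk
  rw [Complex.im_ofReal_mul, Complex.mul_im, hkre, hw0] at him
  simp only [Complex.mul_im, Complex.sub_im, Complex.sub_re, Complex.ofReal_re, Complex.ofReal_im,
    Complex.mul_re, Complex.I_re, Complex.I_im, hS0] at him
  have hpos : 0 < ‖α 0‖ ^ 2 * a := mul_pos (by positivity) hα.pos
  have hS1 : S.im = 0 := by
    have : ‖α 0‖ ^ 2 * a * S.im = 0 := by linarith
    exact (mul_eq_zero.1 this).resolve_left hpos.ne'
  have hSz : S = 0 := Complex.ext hS0 hS1
  have h1 : h.1 = 0 := by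
    refine (mul_eq_zero.1 hSz).resolve_left ?_
    rw [map_eq_zero_iff _ (star_injective : Function.Injective (conj : ℂ → ℂ))]
    exact hd.ne
  exact Prod.ext h1 (by rw [h2, h1]; simp)

/-- Near the shape of the burst, the invariants control the shape. -/
theorem exists_norm_sub_le_shapeInv {ξ a b : ℝ} {α : Fin 3 → ℂ} (hα : IsSelfSimilar ξ a b α)
    (hξ : ξ ≠ 0) : ∃ K : ℝ, ∀ᶠ p : (ℂ × ℂ) × ℂ × ℂ in 𝓝 (shape α, shape α),
      ‖p.1 - p.2‖ ≤ K * ‖shapeInv p.1 - shapeInv p.2‖ := by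
  have hs := (contDiffAt_shapeInv (hα.distinct_shape hξ)).hasStrictFDerivAt one_ne_zero
  obtain ⟨K, -, hK⟩ := LinearMap.exists_antilipschitzWith
    (fderiv ℝ shapeInv (shape α)).toLinearMap
    (LinearMap.ker_eq_bot'.2 fun h hh => fderiv_shapeInv_injective hα hξ hh)
  have h1 : (fun p : (ℂ × ℂ) × ℂ × ℂ => p.1 - p.2) =O[𝓝 (shape α, shape α)]
      fun p => fderiv ℝ shapeInv (shape α) (p.1 - p.2) := by
    refine IsBigO.of_bound K (Eventually.of_forall fun p => ?_)
    simpa using hK.le_mul_dist (p.1 - p.2) 0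
  -- The remainder of strict differentiability is small against the linear part, which is bounded
  -- below by injectivity in finite dimension; it can therefore be absorbed.
  have h2 := hs.isLittleO.trans_isBigO h1
  have h3 := h1.trans h2.right_isBigO_add
  obtain ⟨c, hc⟩ := h3.bound
  exact ⟨c, hc.mono fun p hp => by simpa using hp⟩

/-! ### Evolution of the conserved quantities along one perturbed burst -/

theorem tendsto_sqrt_nhdsGT_zero : Tendsto (fun t : ℝ => √t) (𝓝[>] 0) (𝓝 0) := by
  have := Real.continuous_sqrt.tendsto 0
  rw [Real.sqrt_zero] at this
  exact this.mono_left nhdsWithin_le_nhds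

/-- The positions of the last two vortices relative to the first one. -/
noncomputable def relShape (z : Fin 3 → ℝ → ℂ) (t : ℝ) : ℂ × ℂ := (z 1 t / z 0 t, z 2 t / z 0 t)

/-- Three vortices on a short interval `(0, T)`, subject to bounded forces `φ`, that are close to
the self-similar burst, with squared radius `ζ` and angular deviation `η`. -/
structure PerturbedBurst (ξ a b : ℝ) (α : Fin 3 → ℂ) (B T : ℝ) (z φ : Fin 3 → ℝ → ℂ)
    (ζ η : ℝ → ℝ) : Prop where
  sqrt_le : √T ≤ a
  le_one : T ≤ 1
  distinct : ∀ t ∈ Ioo 0 T, Distinct (relShape z t)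
  deriv : ∀ t ∈ Ioo 0 T, ∀ j,
    HasDerivAt (z j) (conj (kap ξ * shapeVel (relShape z t) j / z 0 t + φ j t)) t
  force : ∀ t ∈ Ioo 0 T, ∀ j, ‖φ j t‖ ≤ B
  polar : ∀ t ∈ Ioo 0 T,
    z 0 t = α 0 * (√(ζ t) * Complex.exp (((η t + b / (2 * a) * Real.log t : ℝ) : ℂ) * Complex.I))
  radius : ∀ t ∈ Ioo 0 T, |ζ t - 2 * a * t| ≤ t * √t
  shape : ∀ t ∈ Ioo 0 T, ‖relShape z t - VortexBurst.shape α‖ ≤ √t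
  angle_le : ∀ t ∈ Ioo 0 T, |η t| ≤ √T
  angle : Tendsto η (𝓝[<] T) (𝓝 0)

namespace PerturbedBurst

variable {ξ a b B T : ℝ} {α : Fin 3 → ℂ} {z φ : Fin 3 → ℝ → ℂ} {ζ η : ℝ → ℝ} {t : ℝ}

theorem le_radius (h : PerturbedBurst ξ a b α B T z φ ζ η) (ht : t ∈ Ioo 0 T) : a * t ≤ ζ t := by
  have h1 : √t ≤ a := (Real.sqrt_le_sqrt ht.2.le).trans h.sqrt_le
  have h2 := (abs_le.1 (h.radius t ht)).1
  nlinarith [mul_le_mul_of_nonneg_left h1 ht.1.le]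

theorem radius_le (h : PerturbedBurst ξ a b α B T z φ ζ η) (ht : t ∈ Ioo 0 T) :
    ζ t ≤ 3 * a * t := by
  have h1 : √t ≤ a := (Real.sqrt_le_sqrt ht.2.le).trans h.sqrt_le
  have h2 := (abs_le.1 (h.radius t ht)).2
  nlinarith [mul_le_mul_of_nonneg_left h1 ht.1.le]

theorem norm_fst (h : PerturbedBurst ξ a b α B T z φ ζ η) (ht : t ∈ Ioo 0 T) :
    ‖z 0 t‖ = ‖α 0‖ * √(ζ t) := by
  rw [h.polar t ht, norm_mul, norm_mul, Complex.norm_exp_ofReal_mul_I, mul_one, Complex.norm_real,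
    Real.norm_of_nonneg (Real.sqrt_nonneg _)]

theorem norm_fst_sq (h : PerturbedBurst ξ a b α B T z φ ζ η) (ha : 0 < a) (ht : t ∈ Ioo 0 T) :
    ‖z 0 t‖ ^ 2 = ‖α 0‖ ^ 2 * ζ t := by
  have h1 : 0 ≤ ζ t := (mul_pos ha ht.1).le.trans (h.le_radius ht)
  rw [h.norm_fst ht, mul_pow, Real.sq_sqrt h1]

theorem fst_ne_zero (h : PerturbedBurst ξ a b α B T z φ ζ η) (ha : 0 < a) (hα : α 0 ≠ 0)
    (ht : t ∈ Ioo 0 T) : z 0 t ≠ 0 := by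
  have h1 : 0 < ζ t := (mul_pos ha ht.1).trans_le (h.le_radius ht)
  rw [← norm_pos_iff, h.norm_fst ht]
  have := norm_pos_iff.2 hα
  positivity

theorem hasDerivAt_center (h : PerturbedBurst ξ a b α B T z φ ζ η) (ht : t ∈ Ioo 0 T) :
    HasDerivAt (fun t => -z 0 t + 2 * z 1 t + 2 * z 2 t)
      (conj (-φ 0 t + 2 * φ 1 t + 2 * φ 2 t)) t := by
  have d := h.deriv t ht
  refine (((d 0).neg.add ((d 1).const_mul 2)).add ((d 2).const_mul 2)).congr_deriv ?_
  have := congrArg (fun x => conj (kap ξ * x / z 0 t)) (shapeVel_sum (y := relShape z t))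
  simp only [map_add, map_mul, map_neg, map_div₀, Complex.conj_ofNat, mul_zero, map_zero,
    zero_div] at this ⊢
  linear_combination this

theorem hasDerivAt_norm_fst_sq (h : PerturbedBurst ξ a b α B T z φ ζ η) (hz : z 0 t ≠ 0)
    (ht : t ∈ Ioo 0 T) :
    HasDerivAt (fun t => ‖z 0 t‖ ^ 2)
      (2 * (kap ξ * shapeVel (relShape z t) 0 + z 0 t * φ 0 t).re) t := by
  refine (hasDerivAt_norm_sq (h.deriv t ht 0)).congr_deriv ?_
  rw [← map_mul, Complex.conj_re]
  congr 2
  field_simp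

theorem hasDerivAt_moment (h : PerturbedBurst ξ a b α B T z φ ζ η) (hz : z 0 t ≠ 0)
    (ht : t ∈ Ioo 0 T) :
    HasDerivAt (fun t => -‖z 0 t‖ ^ 2 + 2 * ‖z 1 t‖ ^ 2 + 2 * ‖z 2 t‖ ^ 2)
      (2 * (-(z 0 t * φ 0 t) + 2 * (z 1 t * φ 1 t) + 2 * (z 2 t * φ 2 t)).re) t := by
  have d := fun j => hasDerivAt_norm_sq (h.deriv t ht j)
  refine (((d 0).neg.add ((d 1).const_mul 2)).add ((d 2).const_mul 2)).congr_deriv ?_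
  have h1 := shapeVel_moment (h.distinct t ht)
  have key : -(z 0 t * φ 0 t) + 2 * (z 1 t * φ 1 t) + 2 * (z 2 t * φ 2 t) =
      -(z 0 t * (kap ξ * shapeVel (relShape z t) 0 / z 0 t + φ 0 t)) +
      2 * (z 1 t * (kap ξ * shapeVel (relShape z t) 1 / z 0 t + φ 1 t)) +
      2 * (z 2 t * (kap ξ * shapeVel (relShape z t) 2 / z 0 t + φ 2 t)) := by
    have h2 := congrArg (kap ξ * ·) h1
    simp only [mul_zero] at h2
    have e1 : (relShape z t).1 = z 1 t / z 0 t := rfl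
    have e2 : (relShape z t).2 = z 2 t / z 0 t := rfl
    rw [e1, e2] at h2
    field_simp at h2 ⊢
    linear_combination -h2
  rw [key]
  have e : ∀ w x : ℂ, (conj w * conj x).re = (w * x).re := fun w x => by
    rw [← map_mul, Complex.conj_re]
  have e2 : ∀ w : ℂ, (2 * w).re = 2 * w.re := fun w => by simp
  simp only [e, Complex.add_re (_ + _), Complex.add_re (-_), Complex.neg_re, e2]
  ring

/-- The logarithmic derivative of the cross ratio is given by `shapeVel` itself, so the free part of
the motion contributes a real multiple of conj κ, which has no real part. Only the forces survive,
with a singular factor 1/z₀. -/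
theorem hasDerivAt_energy (h : PerturbedBurst ξ a b α B T z φ ζ η) (hz : z 0 t ≠ 0)
    (ht : t ∈ Ioo 0 T) :
    HasDerivAt (fun t => ‖crossRatio (relShape z t)‖ ^ 2)
      (‖crossRatio (relShape z t)‖ ^ 2 *
        ((shapeVel (relShape z t) 0 * conj (φ 0 t) - 2 * (shapeVel (relShape z t) 1 * conj (φ 1 t))
          - 2 * (shapeVel (relShape z t) 2 * conj (φ 2 t))) * (z 0 t)⁻¹).re) t := by
  have d := h.deriv t ht
  have h0 := hasDerivAt_norm_sq (hasDerivAt_crossRatio ((d 1).div (d 0) hz) ((d 2).div (d 0) hz)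
    (h.distinct t ht))
  have e1 : (z 1 t / z 0 t, z 2 t / z 0 t) = relShape z t := rfl
  simp only [Pi.div_apply] at h0
  have hm := shapeVel_moment (h.distinct t ht)
  have hm' : -shapeVel (relShape z t) 0 + 2 * (z 1 t / z 0 t) * shapeVel (relShape z t) 1 +
      2 * (z 2 t / z 0 t) * shapeVel (relShape z t) 2 = 0 := hm
  refine h0.congr_deriv ?_
  rw [e1]
  set G := shapeVel (relShape z t)
  set k := crossRatio (relShape z t)
  have hzc : conj (z 0 t) ≠ 0 := by simpa using hz
  -- The derivative splits into the force terms and a real number times conj κ. The virial identity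
  -- eliminates the combination of positions and velocities.
  have key : 2 * (conj k * -(k * (G 1 *
      ((conj (kap ξ * G 1 / z 0 t + φ 1 t) * z 0 t - z 1 t * conj (kap ξ * G 0 / z 0 t + φ 0 t)) /
        z 0 t ^ 2) + G 2 *
      ((conj (kap ξ * G 2 / z 0 t + φ 2 t) * z 0 t - z 2 t * conj (kap ξ * G 0 / z 0 t + φ 0 t)) /
        z 0 t ^ 2)))) =
      ((‖k‖ ^ 2 : ℝ) : ℂ) * ((G 0 * conj (φ 0 t) - 2 * (G 1 * conj (φ 1 t))
          - 2 * (G 2 * conj (φ 2 t))) * (z 0 t)⁻¹ +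
        ((((‖G 0‖ ^ 2 - 2 * ‖G 1‖ ^ 2 - 2 * ‖G 2‖ ^ 2) / ‖z 0 t‖ ^ 2 : ℝ) : ℂ) *
          conj (kap ξ))) := by
    push_cast
    simp only [← Complex.mul_conj', map_add, map_mul, map_div₀]
    field_simp at hm' ⊢
    have hG : G 0 * z 0 t = 2 * (z 1 t * G 1 + z 2 t * G 2) := by linear_combination -hm'
    linear_combination
      -(k * conj k) * (conj (z 0 t) * conj (φ 0 t) + conj (kap ξ) * conj (G 0)) * hG
  have e2 : ∀ w : ℂ, 2 * w.re = (2 * w).re := fun w => by simp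
  have hkre : (conj (kap ξ)).re = 0 := by
    have := congrArg Complex.re (conj_kap ξ)
    simp only [Complex.conj_re, Complex.neg_re] at this ⊢
    linarith
  rw [e2, key, Complex.re_ofReal_mul, Complex.add_re, Complex.re_ofReal_mul, hkre, mul_zero,
    add_zero]

theorem tendsto_radius (h : PerturbedBurst ξ a b α B T z φ ζ η) (hT : 0 < T) :
    Tendsto ζ (𝓝[>] 0) (𝓝 0) := by
  have hlim : ∀ c : ℝ, Tendsto (fun t : ℝ => c * t) (𝓝[>] 0) (𝓝 0) := fun c => by
    have : Tendsto (fun t : ℝ => c * t) (𝓝 0) (𝓝 (c * 0)) := tendsto_id.const_mul c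
    rw [mul_zero] at this
    exact this.mono_left nhdsWithin_le_nhds
  refine tendsto_of_tendsto_of_tendsto_of_le_of_le' (hlim a) (hlim (3 * a)) ?_ ?_
  · filter_upwards [Ioo_mem_nhdsGT hT] with t ht using h.le_radius ht
  · filter_upwards [Ioo_mem_nhdsGT hT] with t ht using h.radius_le ht

theorem tendsto_norm_fst_sq (h : PerturbedBurst ξ a b α B T z φ ζ η) (ha : 0 < a) (hT : 0 < T) :
    Tendsto (fun t => ‖z 0 t‖ ^ 2) (𝓝[>] 0) (𝓝 0) := by
  have := (h.tendsto_radius hT).const_mul (‖α 0‖ ^ 2)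
  rw [mul_zero] at this
  refine this.congr' ?_
  filter_upwards [Ioo_mem_nhdsGT hT] with t ht using (h.norm_fst_sq ha ht).symm

theorem tendsto_relShape (h : PerturbedBurst ξ a b α B T z φ ζ η) (hT : 0 < T) :
    Tendsto (relShape z) (𝓝[>] 0) (𝓝 (VortexBurst.shape α)) := by
  rw [tendsto_iff_norm_sub_tendsto_zero]
  refine squeeze_zero' (Eventually.of_forall fun t => norm_nonneg _) ?_ tendsto_sqrt_nhdsGT_zero
  filter_upwards [Ioo_mem_nhdsGT hT] with t ht using h.shape t ht

theorem tendsto_position (h : PerturbedBurst ξ a b α B T z φ ζ η) (ha : 0 < a) (hα : α 0 ≠ 0)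
    (hT : 0 < T) (j : Fin 3) : Tendsto (z j) (𝓝[>] 0) (𝓝 0) := by
  have h0 : Tendsto (z 0) (𝓝[>] 0) (𝓝 0) := by
    rw [tendsto_zero_iff_norm_tendsto_zero]
    have := (h.tendsto_norm_fst_sq ha hT).sqrt
    simpa [Real.sqrt_sq] using this
  have hs := h.tendsto_relShape hT
  have key : ∀ j, Tendsto (fun t => z j t / z 0 t * z 0 t) (𝓝[>] 0) (𝓝 0) →
      Tendsto (z j) (𝓝[>] 0) (𝓝 0) := fun j hj => by
    refine hj.congr' ?_
    filter_upwards [Ioo_mem_nhdsGT hT] with t ht using div_mul_cancel₀ _ (h.fst_ne_zero ha hα ht)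
  fin_cases j
  · exact h0
  · exact key 1 (by simpa [relShape] using (hs.fst_nhds).mul h0)
  · exact key 2 (by simpa [relShape] using (hs.snd_nhds).mul h0)

end PerturbedBurst

/-! ### Pairs of bursts and their a priori differences -/

/-- The maps `shapeVel` and `shapeInv` are Lipschitz on the ball of radius `r` around the shape of
the burst, and there `shapeInv` has a Lipschitz inverse. -/
structure IsRegularBall (α : Fin 3 → ℂ) (r K : ℝ) : Prop where
  pos : 0 < r
  vel : ∀ y ∈ Metric.closedBall (shape α) r, ∀ y' ∈ Metric.closedBall (shape α) r,
    ‖shapeVel y - shapeVel y'‖ ≤ K * ‖y - y'‖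
  inv : ∀ y ∈ Metric.closedBall (shape α) r, ∀ y' ∈ Metric.closedBall (shape α) r,
    ‖shapeInv y - shapeInv y'‖ ≤ K * ‖y - y'‖
  inv_rev : ∀ y ∈ Metric.closedBall (shape α) r, ∀ y' ∈ Metric.closedBall (shape α) r,
    ‖y - y'‖ ≤ K * ‖shapeInv y - shapeInv y'‖

theorem exists_isRegularBall {ξ a b : ℝ} {α : Fin 3 → ℂ} (hα : IsSelfSimilar ξ a b α)
    (hξ : ξ ≠ 0) : ∃ r K, IsRegularBall α r K := by
  have hd := hα.distinct_shape hξ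
  obtain ⟨K₁, s₁, hs₁, h₁⟩ := (contDiffAt_shapeVel hd).exists_lipschitzOnWith
  obtain ⟨K₂, s₂, hs₂, h₂⟩ := (contDiffAt_shapeInv hd).exists_lipschitzOnWith
  obtain ⟨K₃, h₃⟩ := exists_norm_sub_le_shapeInv hα hξ
  obtain ⟨s₃, hs₃, h₃⟩ := (eventually_prod_self_iff (r := fun y y' => ‖y - y'‖ ≤
    K₃ * ‖shapeInv y - shapeInv y'‖)).1 (by rwa [nhds_prod_eq] at h₃)
  obtain ⟨r, hr, hball⟩ := Metric.nhds_basis_closedBall.mem_iff.1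
    (inter_mem hs₁ (inter_mem hs₂ hs₃))
  refine ⟨r, max (max K₁ K₂) K₃, hr, fun y hy y' hy' => ?_, fun y hy y' hy' => ?_,
    fun y hy y' hy' => ?_⟩
  · refine (h₁.norm_sub_le (hball hy).1 (hball hy').1).trans ?_
    gcongr
    exact (le_max_left _ _).trans (le_max_left _ _)
  · refine (h₂.norm_sub_le (hball hy).2.1 (hball hy').2.1).trans ?_
    gcongr
    exact (le_max_right _ _).trans (le_max_left _ _)
  · refine (h₃ y (hball hy).2.2 y' (hball hy').2.2).trans ?_
    gcongr
    exact le_max_right _ _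

/-- Two curves of triples of vortices with forces, squared radii and angles, on `(0, T)`, and
bounds `N` on the difference of the curves and `D` on the difference of the fields. -/
structure PairData where
  (T N D : ℝ)
  (z φ z' φ' : Fin 3 → ℝ → ℂ)
  (ζ η ζ' η' : ℝ → ℝ)

/-- The total distance of the curves and of the fields. -/
def PairData.err (d : PairData) : ℝ := d.N + d.D

/-- Two perturbed bursts at distance at most `N` in forces that are Lipschitz up to errors `D`. -/
structure IsPair (ξ a b : ℝ) (α : Fin 3 → ℂ) (B r : ℝ) (d : PairData) : Prop where
  fst : PerturbedBurst ξ a b α B d.T d.z d.φ d.ζ d.η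
  snd : PerturbedBurst ξ a b α B d.T d.z' d.φ' d.ζ' d.η'
  sqrt_le : √d.T ≤ r
  nonneg_N : 0 ≤ d.N
  nonneg_D : 0 ≤ d.D
  shape : ∀ t ∈ Ioo 0 d.T, ‖relShape d.z t - relShape d.z' t‖ ≤ d.N
  radius : ∀ t ∈ Ioo 0 d.T, |d.ζ t - d.ζ' t| ≤ d.N * t
  angle : ∀ t ∈ Ioo 0 d.T, |d.η t - d.η' t| ≤ d.N
  force : ∀ t ∈ Ioo 0 d.T, ∀ j, ‖d.φ j t - d.φ' j t‖ ≤ B * (d.D + ‖d.z j t - d.z' j t‖)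

/-- The filter of the families of pairs of perturbed bursts, at all times. -/
def pairFilter (ξ a b : ℝ) (α : Fin 3 → ℂ) (B r : ℝ) : Filter (PairData × ℝ) :=
  𝓟 {p | p.1 ∈ {d | IsPair ξ a b α B r d} ∧ p.2 ∈ Ioo 0 p.1.T}

theorem isBigO_pairFilter {ξ a b : ℝ} {α : Fin 3 → ℂ} {B r : ℝ} {E : Type*}
    [NormedAddCommGroup E] {X : PairData × ℝ → E} {s : PairData × ℝ → ℝ} (c : ℝ)
    (h : ∀ d t, IsPair ξ a b α B r d → t ∈ Ioo 0 d.T → ‖X (d, t)‖ ≤ c * s (d, t)) :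
    X =O[pairFilter ξ a b α B r] s := by
  refine isBigO_principal.2 ⟨‖c‖, ?_⟩
  rintro ⟨d, t⟩ ⟨hd, ht⟩
  rw [← norm_mul]
  exact (h d t hd ht).trans (Real.le_norm_self _)

theorem eventually_pairFilter {ξ a b : ℝ} {α : Fin 3 → ℂ} {B r : ℝ} {P : PairData × ℝ → Prop}
    (h : ∀ d t, IsPair ξ a b α B r d → t ∈ Ioo 0 d.T → P (d, t)) :
    ∀ᶠ p in pairFilter ξ a b α B r, P p :=
  eventually_principal.2 fun p hp => h p.1 p.2 hp.1 hp.2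

theorem abs_sqrt_sub_sqrt_le {x y c : ℝ} (hc : 0 < c) (hx : c ≤ √x) (hx0 : 0 ≤ x) (hy : 0 ≤ y) :
    |√x - √y| ≤ |x - y| / c := by
  have h : x - y = (√x - √y) * (√x + √y) := by
    ring_nf
    rw [Real.sq_sqrt hx0, Real.sq_sqrt hy]
  have h2 : c ≤ √x + √y := by linarith [Real.sqrt_nonneg y]
  rw [le_div_iff₀ hc, h, abs_mul, abs_of_nonneg (hc.le.trans h2)]
  exact mul_le_mul_of_nonneg_left h2 (abs_nonneg _)

theorem norm_exp_sub_exp_le (x y : ℝ) :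
    ‖Complex.exp (x * Complex.I) - Complex.exp (y * Complex.I)‖ ≤ |x - y| := by
  have : Complex.exp (x * Complex.I) - Complex.exp (y * Complex.I) =
      Complex.exp (y * Complex.I) * (Complex.exp (Complex.I * ((x - y : ℝ) : ℂ)) - 1) := by
    rw [mul_sub, ← Complex.exp_add]
    push_cast
    ring_nf
  rw [this, norm_mul, Complex.norm_exp_ofReal_mul_I, one_mul]
  exact Real.norm_exp_I_mul_ofReal_sub_one_le

section

variable {ξ a b B r K : ℝ} {α : Fin 3 → ℂ}

/-- The unbounded phase (b/2a) log t is common to both curves and drops out. Since ζ is comparable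
to t, a difference N t of the squared radii becomes N√t after the square root. -/
theorem near_fst (ha : 0 < a) :
    Near (pairFilter ξ a b α B r) (fun p => √p.2) (fun p => p.1.err) (fun p => p.1.z 0 p.2)
      (fun p => p.1.z' 0 p.2) := by
  have hbd : ∀ {T t : ℝ} {z φ : Fin 3 → ℝ → ℂ} {ζ η : ℝ → ℝ},
      PerturbedBurst ξ a b α B T z φ ζ η → t ∈ Ioo 0 T → √(ζ t) ≤ √(3 * a) * √t := by
    intro T t z φ ζ η h ht
    rw [← Real.sqrt_mul (by positivity)]
    exact Real.sqrt_le_sqrt (h.radius_le ht)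
  have hlow : ∀ {T t : ℝ} {z φ : Fin 3 → ℝ → ℂ} {ζ η : ℝ → ℝ},
      PerturbedBurst ξ a b α B T z φ ζ η → t ∈ Ioo 0 T → √a * √t ≤ √(ζ t) := by
    intro T t z φ ζ η h ht
    rw [← Real.sqrt_mul ha.le]
    exact Real.sqrt_le_sqrt (h.le_radius ht)
  refine ⟨isBigO_pairFilter (‖α 0‖ * √(3 * a)) fun d t hd ht => ?_,
    isBigO_pairFilter (‖α 0‖ * √(3 * a)) fun d t hd ht => ?_,
    isBigO_pairFilter (‖α 0‖ * (1 / √a + √(3 * a))) fun d t hd ht => ?_⟩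
  · rw [hd.fst.norm_fst ht, mul_assoc]
    exact mul_le_mul_of_nonneg_left (hbd hd.fst ht) (norm_nonneg _)
  · rw [hd.snd.norm_fst ht, mul_assoc]
    exact mul_le_mul_of_nonneg_left (hbd hd.snd ht) (norm_nonneg _)
  · have hz : 0 ≤ d.ζ t := (mul_pos ha ht.1).le.trans (hd.fst.le_radius ht)
    have hz' : 0 ≤ d.ζ' t := (mul_pos ha ht.1).le.trans (hd.snd.le_radius ht)
    have hst : 0 < √t := Real.sqrt_pos.2 ht.1
    have hsa : 0 < √a := Real.sqrt_pos.2 ha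
    have h1 : |√(d.ζ t) - √(d.ζ' t)| ≤ 1 / √a * √t * d.N := by
      refine (abs_sqrt_sub_sqrt_le (mul_pos hsa hst) (hlow hd.fst ht) hz hz').trans ?_
      rw [div_le_iff₀ (by positivity)]
      refine (hd.radius t ht).trans (le_of_eq ?_)
      field_simp
      rw [Real.sq_sqrt ht.1.le]
    have h2 := norm_exp_sub_exp_le (d.η t + b / (2 * a) * Real.log t)
      (d.η' t + b / (2 * a) * Real.log t)
    rw [add_sub_add_right_eq_sub] at h2
    have h3 := h2.trans (hd.angle t ht)
    simp only [PairData.err]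
    rw [hd.fst.polar t ht, hd.snd.polar t ht, ← mul_sub, norm_mul, mul_assoc]
    refine mul_le_mul_of_nonneg_left ?_ (norm_nonneg _)
    set E := Complex.exp (((d.η t + b / (2 * a) * Real.log t : ℝ) : ℂ) * Complex.I) with hE
    set E' := Complex.exp (((d.η' t + b / (2 * a) * Real.log t : ℝ) : ℂ) * Complex.I)
    have hE1 : ‖E‖ = 1 := Complex.norm_exp_ofReal_mul_I _
    have h4 : (√(d.ζ t) : ℂ) * E - √(d.ζ' t) * E' =
        ((√(d.ζ t) - √(d.ζ' t) : ℝ) : ℂ) * E + (√(d.ζ' t) : ℂ) * (E - E') := by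
      push_cast
      ring
    rw [h4]
    refine (norm_add_le _ _).trans ?_
    rw [norm_mul, norm_mul, hE1, mul_one, Complex.norm_real, Complex.norm_real, Real.norm_eq_abs,
      Real.norm_of_nonneg (Real.sqrt_nonneg _)]
    have h5 := mul_le_mul (hbd hd.snd ht) h3 (norm_nonneg _) (by positivity)
    have h6 : 0 ≤ (1 / √a + √(3 * a)) * √t * d.D :=
      mul_nonneg (by positivity) hd.nonneg_D
    nlinarith

theorem near_inv_fst (ha : 0 < a) (hα : α 0 ≠ 0) :
    Near (pairFilter ξ a b α B r) (fun p => (√p.2)⁻¹) (fun p => p.1.err) (fun p => (p.1.z 0 p.2)⁻¹)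
      (fun p => (p.1.z' 0 p.2)⁻¹) := by
  have hlow : ∀ {T t : ℝ} {z φ : Fin 3 → ℝ → ℂ} {ζ η : ℝ → ℝ},
      PerturbedBurst ξ a b α B T z φ ζ η → t ∈ Ioo 0 T →
        ‖(z 0 t)⁻¹‖ ≤ (‖α 0‖ * √a)⁻¹ * (√t)⁻¹ := by
    intro T t z φ ζ η h ht
    have hst : 0 < √t := Real.sqrt_pos.2 ht.1
    have hsa : 0 < √a := Real.sqrt_pos.2 ha
    have hα' := norm_pos_iff.2 hα
    rw [norm_inv, h.norm_fst ht, ← mul_inv, mul_assoc]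
    refine inv_anti₀ (by positivity) (mul_le_mul_of_nonneg_left ?_ hα'.le)
    rw [← Real.sqrt_mul ha.le]
    exact Real.sqrt_le_sqrt (h.le_radius ht)
  exact (near_fst ha).inv
    (eventually_pairFilter fun d t hd ht => hd.fst.fst_ne_zero ha hα ht)
    (eventually_pairFilter fun d t hd ht => hd.snd.fst_ne_zero ha hα ht)
    (isBigO_pairFilter _ fun d t hd ht => hlow hd.fst ht)
    (isBigO_pairFilter _ fun d t hd ht => hlow hd.snd ht)

theorem near_relShape : Near (pairFilter ξ a b α B r) (fun _ => 1) (fun p => p.1.err)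
    (fun p => relShape p.1.z p.2) (fun p => relShape p.1.z' p.2) := by
  have hbd : ∀ {T t : ℝ} {z φ : Fin 3 → ℝ → ℂ} {ζ η : ℝ → ℝ},
      PerturbedBurst ξ a b α B T z φ ζ η → t ∈ Ioo 0 T →
        ‖relShape z t‖ ≤ (‖shape α‖ + 1) * 1 := by
    intro T t z φ ζ η h ht
    have h1 := h.shape t ht
    have h2 : √t ≤ 1 := Real.sqrt_le_one.2 (ht.2.le.trans h.le_one)
    have h3 := norm_le_insert' (relShape z t) (shape α)
    linarith
  refine ⟨isBigO_pairFilter _ fun d t hd ht => hbd hd.fst ht,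
    isBigO_pairFilter _ fun d t hd ht => hbd hd.snd ht, isBigO_pairFilter 1 fun d t hd ht => ?_⟩
  have := hd.shape t ht
  have := hd.nonneg_D
  simp only [PairData.err]
  linarith

theorem near_position (ha : 0 < a) (hα : α 0 ≠ 0) (j : Fin 3) :
    Near (pairFilter ξ a b α B r) (fun p => √p.2) (fun p => p.1.err) (fun p => p.1.z j p.2)
      (fun p => p.1.z' j p.2) := by
  have h0 := near_fst (ξ := ξ) (b := b) (α := α) (B := B) (r := r) ha
  have hs := near_relShape (ξ := ξ) (a := a) (b := b) (α := α) (B := B) (r := r)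
  have key : ∀ j, Near (pairFilter ξ a b α B r) (fun _ => 1) (fun p => p.1.err)
      (fun p => p.1.z j p.2 / p.1.z 0 p.2) (fun p => p.1.z' j p.2 / p.1.z' 0 p.2) →
      Near (pairFilter ξ a b α B r) (fun p => √p.2) (fun p => p.1.err) (fun p => p.1.z j p.2)
        (fun p => p.1.z' j p.2) := fun j hj => by
    refine ((hj.mul h0).congr_scale (.of_forall fun p => one_mul _)).congr ?_ ?_
    · exact eventually_pairFilter fun d t hd ht =>
        div_mul_cancel₀ _ (hd.fst.fst_ne_zero ha hα ht)
    · exact eventually_pairFilter fun d t hd ht =>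
        div_mul_cancel₀ _ (hd.snd.fst_ne_zero ha hα ht)
  fin_cases j
  · exact h0
  · exact key 1 (hs.comp_norm_le (φ := Prod.fst) norm_fst_le fun x y => norm_fst_le (x - y))
  · exact key 2 (hs.comp_norm_le (φ := Prod.snd) norm_snd_le fun x y => norm_snd_le (x - y))

/-- The Lipschitz part of the force difference is controlled by the positions, whose difference is
at most a constant times the total error since t ≤ 1. -/
theorem near_force (ha : 0 < a) (hα : α 0 ≠ 0) (j : Fin 3) :
    Near (pairFilter ξ a b α B r) (fun _ => 1) (fun p => p.1.err) (fun p => p.1.φ j p.2)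
      (fun p => p.1.φ' j p.2) := by
  refine ⟨isBigO_pairFilter B fun d t hd ht => ?_, isBigO_pairFilter B fun d t hd ht => ?_, ?_⟩
  · simpa using hd.fst.force t ht j
  · simpa using hd.snd.force t ht j
  have h1 : (fun p : PairData × ℝ => p.1.φ j p.2 - p.1.φ' j p.2) =O[pairFilter ξ a b α B r]
      fun p => p.1.D + ‖p.1.z j p.2 - p.1.z' j p.2‖ :=
    isBigO_pairFilter B fun d t hd ht => hd.force t ht j
  refine h1.trans (IsBigO.add (isBigO_pairFilter 1 fun d t hd ht => ?_) ?_)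
  · rw [Real.norm_of_nonneg hd.nonneg_D]
    simp only [PairData.err]
    linarith [hd.nonneg_N]
  · refine ((near_position ha hα j).diff.norm_left).trans
      (isBigO_pairFilter 1 fun d t hd ht => ?_)
    have h2 : √t ≤ 1 := Real.sqrt_le_one.2 (ht.2.le.trans hd.fst.le_one)
    have h3 : 0 ≤ d.err := add_nonneg hd.nonneg_N hd.nonneg_D
    rw [Real.norm_of_nonneg (mul_nonneg (Real.sqrt_nonneg _) h3)]
    nlinarith

end

/-! ### Improved differences from the conservation laws -/

section

theorem hasDerivAt_two_mul_sqrt {t : ℝ} (ht : 0 < t) :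
    HasDerivAt (fun t : ℝ => 2 * √t) (√t)⁻¹ t := by
  refine ((Real.hasDerivAt_sqrt ht.ne').const_mul 2).congr_deriv ?_
  field_simp

theorem hasDerivAt_mul_sqrt {t : ℝ} (ht : 0 < t) :
    HasDerivAt (fun t : ℝ => 2 / 3 * (t * √t)) √t t := by
  refine (((hasDerivAt_id t).mul (Real.hasDerivAt_sqrt ht.ne')).const_mul (2 / 3)).congr_deriv ?_
  have : √t ≠ 0 := (Real.sqrt_pos.2 ht).ne'
  simp only [id]
  field_simp
  rw [Real.sq_sqrt ht.le]
  ring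

theorem tendsto_mul_sqrt : Tendsto (fun t : ℝ => 2 / 3 * (t * √t)) (𝓝[>] 0) (𝓝 0) := by
  have h : Tendsto (fun t : ℝ => t) (𝓝[>] 0) (𝓝 0) := nhdsWithin_le_nhds
  simpa using (h.mul tendsto_sqrt_nhdsGT_zero).const_mul (2 / 3)

namespace PerturbedBurst

variable {ξ a b B T : ℝ} {α : Fin 3 → ℂ} {z φ z' φ' : Fin 3 → ℝ → ℂ} {ζ η ζ' η' : ℝ → ℝ} {t : ℝ}

theorem abs_angle_sub_lt (h : PerturbedBurst ξ a b α B T z φ ζ η)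
    (h' : PerturbedBurst ξ a b α B T z' φ' ζ' η') (ht : t ∈ Ioo 0 T) :
    |η t - η' t| < Real.pi := by
  have h1 : √T ≤ 1 := Real.sqrt_le_one.2 h.le_one
  have h2 := abs_sub (η t) (η' t)
  linarith [h.angle_le t ht, h'.angle_le t ht, Real.pi_gt_three]

/-- The terms in log t cancel in the quotient, and |η - η'| ≤ 2√T ≤ 2 < π keeps the angle on the
principal branch. -/
theorem arg_div (h : PerturbedBurst ξ a b α B T z φ ζ η)
    (h' : PerturbedBurst ξ a b α B T z' φ' ζ' η') (ha : 0 < a) (hα : α 0 ≠ 0)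
    (ht : t ∈ Ioo 0 T) : (z 0 t / z' 0 t).arg = η t - η' t := by
  have hz : 0 < √(ζ t) := Real.sqrt_pos.2 ((mul_pos ha ht.1).trans_le (h.le_radius ht))
  have hz' : 0 < √(ζ' t) := Real.sqrt_pos.2 ((mul_pos ha ht.1).trans_le (h'.le_radius ht))
  have hab := abs_lt.1 (h.abs_angle_sub_lt h' ht)
  have key : z 0 t / z' 0 t = ((√(ζ t) / √(ζ' t) : ℝ) : ℂ) *
      (Complex.cos ((η t - η' t : ℝ) : ℂ) + Complex.sin ((η t - η' t : ℝ) : ℂ) * Complex.I) := by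
    rw [← Complex.exp_mul_I, h.polar t ht, h'.polar t ht, mul_div_mul_left _ _ hα,
      mul_div_mul_comm, ← Complex.exp_sub]
    push_cast
    ring_nf
  rw [key, Complex.arg_mul_cos_add_sin_mul_I (div_pos hz hz') ⟨hab.1, hab.2.le⟩]

/-- No differentiability of η is assumed; the imaginary part of this logarithm is η - η' and makes
the angle difference accessible to integration. -/
theorem hasDerivAt_log_div (h : PerturbedBurst ξ a b α B T z φ ζ η)
    (h' : PerturbedBurst ξ a b α B T z' φ' ζ' η') (ha : 0 < a) (hα : α 0 ≠ 0)
    (ht : t ∈ Ioo 0 T) :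
    HasDerivAt (fun t => Complex.log (z 0 t / z' 0 t))
      ((conj (kap ξ * shapeVel (relShape z t) 0) * (((‖z 0 t‖ * ‖z 0 t‖)⁻¹ : ℝ) : ℂ) +
          conj (φ 0 t) * (z 0 t)⁻¹) -
        (conj (kap ξ * shapeVel (relShape z' t) 0) * (((‖z' 0 t‖ * ‖z' 0 t‖)⁻¹ : ℝ) : ℂ) +
          conj (φ' 0 t) * (z' 0 t)⁻¹)) t := by
  have hz := h.fst_ne_zero ha hα ht
  have hz' := h'.fst_ne_zero ha hα ht
  have hc : conj (z 0 t) ≠ 0 := by simpa using hz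
  have hc' : conj (z' 0 t) ≠ 0 := by simpa using hz'
  have hab := abs_lt.1 (h.abs_angle_sub_lt h' ht)
  have hsl : z 0 t / z' 0 t ∈ Complex.slitPlane := by
    rw [Complex.mem_slitPlane_iff_arg, h.arg_div h' ha hα ht]
    exact ⟨hab.2.ne, div_ne_zero hz hz'⟩
  refine (((h.deriv t ht 0).div (h'.deriv t ht 0) hz').clog_real hsl).congr_deriv ?_
  simp only [Pi.div_apply]
  push_cast
  rw [← pow_two, ← pow_two, ← Complex.mul_conj', ← Complex.mul_conj']
  simp only [map_add, map_mul, map_div₀]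
  field_simp

end PerturbedBurst

variable {ξ a b B r K : ℝ} {α : Fin 3 → ℂ}

namespace IsPair

variable {d : PairData} {t : ℝ}

theorem err_nonneg (hd : IsPair ξ a b α B r d) : 0 ≤ d.err := add_nonneg hd.nonneg_N hd.nonneg_D

theorem fst_mem (hd : IsPair ξ a b α B r d) (ht : t ∈ Ioo 0 d.T) :
    relShape d.z t ∈ Metric.closedBall (VortexBurst.shape α) r := by
  rw [mem_closedBall_iff_norm]
  exact (hd.fst.shape t ht).trans ((Real.sqrt_le_sqrt ht.2.le).trans hd.sqrt_le)

theorem snd_mem (hd : IsPair ξ a b α B r d) (ht : t ∈ Ioo 0 d.T) :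
    relShape d.z' t ∈ Metric.closedBall (VortexBurst.shape α) r := by
  rw [mem_closedBall_iff_norm]
  exact (hd.snd.shape t ht).trans ((Real.sqrt_le_sqrt ht.2.le).trans hd.sqrt_le)

end IsPair

theorem near_of_lipschitz {E : Type*} [NormedAddCommGroup E] {F : ℂ × ℂ → E}
    (hr : 0 ≤ r)
    (hF : ∀ y ∈ Metric.closedBall (shape α) r, ∀ y' ∈ Metric.closedBall (shape α) r,
      ‖F y - F y'‖ ≤ K * ‖y - y'‖) {e : PairData × ℝ → ℝ}
    (h : Near (pairFilter ξ a b α B r) (fun _ => 1) e (fun p => relShape p.1.z p.2)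
      (fun p => relShape p.1.z' p.2)) :
    Near (pairFilter ξ a b α B r) (fun _ => 1) e (fun p => F (relShape p.1.z p.2))
      (fun p => F (relShape p.1.z' p.2)) := by
  have h0 : shape α ∈ Metric.closedBall (shape α) r := Metric.mem_closedBall_self hr
  have hbd : ∀ y ∈ Metric.closedBall (shape α) r, ‖F y‖ ≤ (‖F (shape α)‖ + |K| * r) * 1 := by
    intro y hy
    have h1 := hF y hy _ h0
    have h2 := norm_le_insert' (F y) (F (shape α))
    have h3 : K * ‖y - shape α‖ ≤ |K| * r :=
      mul_le_mul (le_abs_self K) (mem_closedBall_iff_norm.1 hy) (norm_nonneg _) (abs_nonneg _)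
    linarith
  refine ⟨isBigO_pairFilter _ fun d t hd ht => hbd _ (hd.fst_mem ht),
    isBigO_pairFilter _ fun d t hd ht => hbd _ (hd.snd_mem ht), ?_⟩
  exact (isBigO_pairFilter (s := fun p => ‖relShape p.1.z p.2 - relShape p.1.z' p.2‖) K
    fun d t hd ht => hF _ (hd.fst_mem ht) _ (hd.snd_mem ht)).trans h.diff.norm_left

theorem near_shapeVel (hK : IsRegularBall α r K) {e : PairData × ℝ → ℝ}
    (h : Near (pairFilter ξ a b α B r) (fun _ => 1) e (fun p => relShape p.1.z p.2)
      (fun p => relShape p.1.z' p.2)) (j : Fin 3) :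
    Near (pairFilter ξ a b α B r) (fun _ => 1) e (fun p => shapeVel (relShape p.1.z p.2) j)
      (fun p => shapeVel (relShape p.1.z' p.2) j) :=
  (near_of_lipschitz hK.pos.le hK.vel h).comp_norm_le (φ := fun x => x j)
    (fun x => norm_le_pi_norm x j) fun x y => norm_le_pi_norm (x - y) j

/-- The derivative is a combination of bounded forces; integrating from 0 gives the order t. -/
theorem near_center (ha : 0 < a) (hα : α 0 ≠ 0) :
    Near (pairFilter ξ a b α B r) (fun p => p.2) (fun p => p.1.err)
      (fun p => -p.1.z 0 p.2 + 2 * p.1.z 1 p.2 + 2 * p.1.z 2 p.2)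
      (fun p => -p.1.z' 0 p.2 + 2 * p.1.z' 1 p.2 + 2 * p.1.z' 2 p.2) := by
  have hφ := fun j => near_force (ξ := ξ) (b := b) (B := B) (r := r) ha hα j
  have h := (((hφ 0).neg.add ((hφ 1).const_mul 2)).add ((hφ 2).const_mul 2)).star
  have hlim : ∀ {T : ℝ} {z φ : Fin 3 → ℝ → ℂ} {ζ η : ℝ → ℝ},
      PerturbedBurst ξ a b α B T z φ ζ η → 0 < T →
        Tendsto (fun t => -z 0 t + 2 * z 1 t + 2 * z 2 t) (𝓝[>] 0) (𝓝 0) := by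
    intro T z φ ζ η h hT
    have h1 := h.tendsto_position ha hα hT
    simpa using ((h1 0).neg.add ((h1 1).const_mul 2)).add ((h1 2).const_mul 2)
  exact Near.of_deriv (𝒟 := PairData) (T := PairData.T) (w := PairData.err) (b := fun _ => 1)
    (fun d hd t ht => hd.fst.hasDerivAt_center ht) (fun d hd t ht => hd.snd.hasDerivAt_center ht)
    (fun d hd hT => hlim hd.fst hT) (fun d hd hT => hlim hd.snd hT) (fun d hd => hd.err_nonneg)
    (fun _ _ => zero_le_one) (fun t _ => hasDerivAt_id t)
    (by have h : Tendsto (fun t : ℝ => t) (𝓝[>] 0) (𝓝 0) := nhdsWithin_le_nhds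
        exact h) h

/-- The derivative is position times force, of order √t; integration gives t√t. -/
theorem near_moment (ha : 0 < a) (hα : α 0 ≠ 0) :
    Near (pairFilter ξ a b α B r) (fun p => p.2 * √p.2) (fun p => p.1.err)
      (fun p => -‖p.1.z 0 p.2‖ ^ 2 + 2 * ‖p.1.z 1 p.2‖ ^ 2 + 2 * ‖p.1.z 2 p.2‖ ^ 2)
      (fun p => -‖p.1.z' 0 p.2‖ ^ 2 + 2 * ‖p.1.z' 1 p.2‖ ^ 2 + 2 * ‖p.1.z' 2 p.2‖ ^ 2) := by
  have hφ := fun j => (near_position (ξ := ξ) (b := b) (B := B) (r := r) ha hα j).mul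
    (near_force (ξ := ξ) (b := b) (B := B) (r := r) ha hα j)
  have h := (((((hφ 0).neg.add ((hφ 1).const_mul 2)).add ((hφ 2).const_mul 2)).re.const_mul 2
    )).congr_scale (s₁ := fun p => √p.2) (.of_forall fun p => mul_one _)
  have hlim : ∀ {T : ℝ} {z φ : Fin 3 → ℝ → ℂ} {ζ η : ℝ → ℝ},
      PerturbedBurst ξ a b α B T z φ ζ η → 0 < T →
        Tendsto (fun t => -‖z 0 t‖ ^ 2 + 2 * ‖z 1 t‖ ^ 2 + 2 * ‖z 2 t‖ ^ 2) (𝓝[>] 0) (𝓝 0) := by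
    intro T z φ ζ η h hT
    have h1 := fun j => ((h.tendsto_position ha hα hT j).norm).pow 2
    simpa using ((h1 0).neg.add ((h1 1).const_mul 2)).add ((h1 2).const_mul 2)
  refine (Near.of_deriv (𝒟 := PairData) (T := PairData.T) (w := PairData.err)
    (fun d hd t ht => hd.fst.hasDerivAt_moment (hd.fst.fst_ne_zero ha hα ht) ht)
    (fun d hd t ht => hd.snd.hasDerivAt_moment (hd.snd.fst_ne_zero ha hα ht) ht)
    (fun d hd hT => hlim hd.fst hT) (fun d hd hT => hlim hd.snd hT) (fun d hd => hd.err_nonneg)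
    (fun _ _ => Real.sqrt_nonneg _) (fun t ht => hasDerivAt_mul_sqrt ht) tendsto_mul_sqrt h).mono
    ((isBigO_refl _ _).const_mul_left _)

theorem near_norm_crossRatio (hK : IsRegularBall α r K) :
    Near (pairFilter ξ a b α B r) (fun _ => 1) (fun p => p.1.err)
      (fun p => ‖crossRatio (relShape p.1.z p.2)‖ ^ 2)
      (fun p => ‖crossRatio (relShape p.1.z' p.2)‖ ^ 2) :=
  (near_of_lipschitz hK.pos.le hK.inv near_relShape).comp_norm_le (φ := fun x => x.2.2)
    (fun x => (norm_snd_le x.2).trans (norm_snd_le x))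
    fun x y => (norm_snd_le (x - y).2).trans (norm_snd_le (x - y))

/-- The derivative carries 1/z₀ and is of order 1/√t, still integrable at 0. Subtracting the value
at the shape of the burst makes the limit at 0 vanish. -/
theorem near_energy (ha : 0 < a) (hα : α 0 ≠ 0) (hd₀ : Distinct (shape α))
    (hK : IsRegularBall α r K) :
    Near (pairFilter ξ a b α B r) (fun p => √p.2) (fun p => p.1.err)
      (fun p => ‖crossRatio (relShape p.1.z p.2)‖ ^ 2 - ‖crossRatio (shape α)‖ ^ 2)
      (fun p => ‖crossRatio (relShape p.1.z' p.2)‖ ^ 2 - ‖crossRatio (shape α)‖ ^ 2) := by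
  have hφ := fun j => (near_shapeVel hK (near_relShape (ξ := ξ) (a := a) (b := b) (B := B)) j).mul
    (near_force (ξ := ξ) (b := b) (B := B) (r := r) ha hα j).star
  have h := ((near_norm_crossRatio (ξ := ξ) (a := a) (b := b) (B := B) hK).mul
    ((((hφ 0).sub ((hφ 1).const_mul 2)).sub ((hφ 2).const_mul 2)).mul
      (near_inv_fst ha hα)).re).congr_scale (s₁ := fun p => (√p.2)⁻¹)
      (.of_forall fun p => by simp)
  have hlim : ∀ {T : ℝ} {z φ : Fin 3 → ℝ → ℂ} {ζ η : ℝ → ℝ},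
      PerturbedBurst ξ a b α B T z φ ζ η → 0 < T →
        Tendsto (fun t => ‖crossRatio (relShape z t)‖ ^ 2 - ‖crossRatio (shape α)‖ ^ 2)
          (𝓝[>] 0) (𝓝 0) := by
    intro T z φ ζ η h hT
    have h1 := ((contDiffAt_crossRatio hd₀).continuousAt.tendsto.comp
      (h.tendsto_relShape hT)).norm.pow 2
    have h2 := h1.sub_const (‖crossRatio (shape α)‖ ^ 2)
    rw [sub_self] at h2
    exact h2
  refine (Near.of_deriv (𝒟 := PairData) (T := PairData.T) (w := PairData.err)
    (fun d hd t ht => (hd.fst.hasDerivAt_energy (hd.fst.fst_ne_zero ha hα ht) ht).sub_const _)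
    (fun d hd t ht => (hd.snd.hasDerivAt_energy (hd.snd.fst_ne_zero ha hα ht) ht).sub_const _)
    (fun d hd hT => hlim hd.fst hT) (fun d hd hT => hlim hd.snd hT) (fun d hd => hd.err_nonneg)
    (fun _ _ => inv_nonneg.2 (Real.sqrt_nonneg _)) (fun t ht => hasDerivAt_two_mul_sqrt ht)
    (by simpa using tendsto_sqrt_nhdsGT_zero.const_mul 2) h).mono
    ((isBigO_refl _ _).const_mul_left _)

/-- The conservation laws bound the difference of the shapes. -/
theorem isBigO_relShape_sub (ha : 0 < a) (hα : α 0 ≠ 0) (hd₀ : Distinct (shape α))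
    (hK : IsRegularBall α r K) :
    (fun p : PairData × ℝ => relShape p.1.z p.2 - relShape p.1.z' p.2)
      =O[pairFilter ξ a b α B r] fun p => √p.2 * p.1.err := by
  have hi := near_inv_fst (ξ := ξ) (b := b) (B := B) (r := r) ha hα
  have hsq : ∀ᶠ p in pairFilter ξ a b α B r, p.2 * (√p.2)⁻¹ = √p.2 :=
    eventually_pairFilter fun d t _ ht => by
      rw [← div_eq_mul_inv, div_eq_iff (Real.sqrt_pos.2 ht.1).ne', Real.mul_self_sqrt ht.1.le]
  have hcenter := (((near_center ha hα).mul hi).congr_scale hsq).diff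
  have hmoment := (((near_moment ha hα).mul (hi.norm.mul hi.norm)).congr_scale
    (s₁ := fun p => √p.2) (eventually_pairFilter fun d t _ ht => by
      have hst := (Real.sqrt_pos.2 ht.1).ne'
      simp only
      field_simp
      rw [Real.sq_sqrt ht.1.le])).diff
  have henergy := (near_energy (ξ := ξ) (b := b) (B := B) ha hα hd₀ hK).diff
  -- The inverse Lipschitz bound on the regular ball turns the differences of the three invariants,
  -- each O(√t) times the error, into one of the shapes.
  refine (isBigO_pairFilter (s := fun p =>
    ‖shapeInv (relShape p.1.z p.2) - shapeInv (relShape p.1.z' p.2)‖) K fun d t hd ht =>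
    hK.inv_rev _ (hd.fst_mem ht) _ (hd.snd_mem ht)).trans (IsBigO.norm_left ?_)
  refine (hcenter.prod_left (hmoment.prod_left henergy)).congr' ?_ .rfl
  refine eventually_pairFilter fun d t hd ht => ?_
  have key : ∀ {T : ℝ} {z φ : Fin 3 → ℝ → ℂ} {ζ η : ℝ → ℝ},
      PerturbedBurst ξ a b α B T z φ ζ η → t ∈ Ioo 0 T →
      shapeInv (relShape z t) = ((-z 0 t + 2 * z 1 t + 2 * z 2 t) * (z 0 t)⁻¹,
        (-‖z 0 t‖ ^ 2 + 2 * ‖z 1 t‖ ^ 2 + 2 * ‖z 2 t‖ ^ 2) * (‖(z 0 t)⁻¹‖ * ‖(z 0 t)⁻¹‖),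
        ‖crossRatio (relShape z t)‖ ^ 2) := by
    intro T z φ ζ η h ht
    have hz := h.fst_ne_zero ha hα ht
    have hz' : ‖z 0 t‖ ≠ 0 := by simpa using hz
    simp only [shapeInv, relShape, norm_div, norm_inv]
    refine Prod.ext ?_ (Prod.ext ?_ rfl)
    · simp only
      field_simp
    · simp only
      field_simp
  simp only
  rw [key hd.fst ht, key hd.snd ht]
  simp only [Prod.mk_sub_mk, sub_sub_sub_cancel_right]

theorem near_relShape_sqrt (ha : 0 < a) (hα : α 0 ≠ 0) (hd₀ : Distinct (shape α))
    (hK : IsRegularBall α r K) :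
    Near (pairFilter ξ a b α B r) (fun _ => 1) (fun p => √p.2 * p.1.err)
      (fun p => relShape p.1.z p.2) (fun p => relShape p.1.z' p.2) :=
  near_relShape.of_diff (by simpa using isBigO_relShape_sub ha hα hd₀ hK)

/-- Each squared radius has a derivative of order one, but this derivative is a function of the
shape plus position times force, so the difference gains √t from the improved shape bound. -/
theorem isBigO_norm_fst_sq_sub (ha : 0 < a) (hα : α 0 ≠ 0) (hd₀ : Distinct (shape α))
    (hK : IsRegularBall α r K) :
    (fun p : PairData × ℝ => ‖p.1.z 0 p.2‖ ^ 2 - ‖p.1.z' 0 p.2‖ ^ 2)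
      =O[pairFilter ξ a b α B r] fun p => p.2 * √p.2 * p.1.err := by
  have h1 := ((near_shapeVel hK (near_relShape_sqrt (ξ := ξ) (b := b) (B := B) ha hα hd₀ hK)
    0).const_mul (kap ξ)).diff.congr_right fun p => one_mul _
  have h2 := ((near_position (ξ := ξ) (b := b) (B := B) (r := r) ha hα 0).mul
    (near_force ha hα 0)).diff.congr_right (g₂ := fun p => √p.2 * p.1.err) fun p => by ring
  have h3 := (h1.add h2).congr_left (f₂ := fun p =>
    (kap ξ * shapeVel (relShape p.1.z p.2) 0 + p.1.z 0 p.2 * p.1.φ 0 p.2) -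
    (kap ξ * shapeVel (relShape p.1.z' p.2) 0 + p.1.z' 0 p.2 * p.1.φ' 0 p.2)) fun p => by ring
  have h4 : (fun p : PairData × ℝ =>
      2 * (kap ξ * shapeVel (relShape p.1.z p.2) 0 + p.1.z 0 p.2 * p.1.φ 0 p.2).re -
      2 * (kap ξ * shapeVel (relShape p.1.z' p.2) 0 + p.1.z' 0 p.2 * p.1.φ' 0 p.2).re)
      =O[pairFilter ξ a b α B r] fun p => √p.2 * p.1.err := by
    refine IsBigO.trans (IsBigO.of_bound 2 (.of_forall fun p => ?_)) h3
    rw [← mul_sub, ← Complex.sub_re, norm_mul]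
    rw [Real.norm_of_nonneg zero_le_two]
    exact mul_le_mul_of_nonneg_left (Complex.abs_re_le_norm _) zero_le_two
  have h5 := isBigO_of_deriv (𝒟 := PairData) (T := PairData.T) (w := PairData.err)
    (X := fun p => ‖p.1.z 0 p.2‖ ^ 2 - ‖p.1.z' 0 p.2‖ ^ 2)
    (fun d hd t ht => ((hd.fst.hasDerivAt_norm_fst_sq (hd.fst.fst_ne_zero ha hα ht) ht).sub
      (hd.snd.hasDerivAt_norm_fst_sq (hd.snd.fst_ne_zero ha hα ht) ht)))
    (fun d hd hT => by
      simpa using (hd.fst.tendsto_norm_fst_sq ha hT).sub (hd.snd.tendsto_norm_fst_sq ha hT))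
    (fun d hd => hd.err_nonneg) (fun _ _ => Real.sqrt_nonneg _)
    (fun t ht => hasDerivAt_mul_sqrt ht) tendsto_mul_sqrt h4
  refine h5.trans ?_
  exact ((isBigO_refl _ _).const_mul_left (2 / 3)).congr_left fun p => by ring

theorem isBigO_radius_sub (ha : 0 < a) (hα : α 0 ≠ 0) (hd₀ : Distinct (shape α))
    (hK : IsRegularBall α r K) :
    (fun p : PairData × ℝ => p.1.ζ p.2 - p.1.ζ' p.2)
      =O[pairFilter ξ a b α B r] fun p => p.2 * √p.2 * p.1.err := by
  refine ((isBigO_norm_fst_sq_sub ha hα hd₀ hK).const_mul_left (‖α 0‖ ^ 2)⁻¹).congr' ?_ .rfl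
  refine eventually_pairFilter fun d t hd ht => ?_
  have h0 := norm_ne_zero_iff.2 hα
  simp only
  rw [hd.fst.norm_fst_sq ha ht, hd.snd.norm_fst_sq ha ht]
  field_simp

/-- The rate of rotation is a function of the shape over |z₀|². The improved shape and radius bounds
reduce its difference from order 1/t, not integrable, to 1/√t. Integration runs up to T, where both
deviations tend to 0, so the gain is √T rather than √t. -/
theorem isBigO_angle_sub (ha : 0 < a) (hα : α 0 ≠ 0) (hd₀ : Distinct (shape α))
    (hK : IsRegularBall α r K) :
    (fun p : PairData × ℝ => p.1.η p.2 - p.1.η' p.2)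
      =O[pairFilter ξ a b α B r] fun p => √p.1.T * p.1.err := by
  have hn := near_fst (ξ := ξ) (b := b) (α := α) (B := B) (r := r) ha
  have hi := near_inv_fst (ξ := ξ) (b := b) (B := B) (r := r) ha hα
  have hsq : ∀ᶠ p in pairFilter ξ a b α B r, √p.2 * √p.2 = p.2 :=
    eventually_pairFilter fun d t _ ht => Real.mul_self_sqrt ht.1.le
  have h1 : Near (pairFilter ξ a b α B r) (fun p => p.2) (fun p => √p.2 * p.1.err)
      (fun p => ‖p.1.z 0 p.2‖ * ‖p.1.z 0 p.2‖) (fun p => ‖p.1.z' 0 p.2‖ * ‖p.1.z' 0 p.2‖) := by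
    refine ((hn.norm.mul hn.norm).congr_scale hsq).of_diff ?_
    refine (isBigO_norm_fst_sq_sub ha hα hd₀ hK).congr (fun p => by ring) fun p => by ring
  have hii := (hi.norm.mul hi.norm).congr_scale (s₁ := fun p => p.2⁻¹)
    (hsq.mono fun p hp => by simp only [← mul_inv, hp])
  have h2 := h1.inv
    (eventually_pairFilter fun d t hd ht => by simpa using hd.fst.fst_ne_zero ha hα ht)
    (eventually_pairFilter fun d t hd ht => by simpa using hd.snd.fst_ne_zero ha hα ht)
    (hii.left.congr_left fun p => by rw [norm_inv, mul_inv])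
    (hii.right.congr_left fun p => by rw [norm_inv, mul_inv])
  have h3 := (((near_shapeVel hK (near_relShape_sqrt (ξ := ξ) (b := b) (B := B) ha hα hd₀ hK)
    0).const_mul (kap ξ)).star.mul h2.ofReal).diff
  have h4 := ((near_force (ξ := ξ) (b := b) (B := B) (r := r) ha hα 0).star.mul hi).diff
  have h5 := (h3.congr' .rfl (g₂ := fun p => (√p.2)⁻¹ * p.1.err) (eventually_pairFilter
    fun d t hd ht => by
      have hst := (Real.sqrt_pos.2 ht.1).ne'
      have := Real.mul_self_sqrt ht.1.le
      simp only [one_mul]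
      rw [← mul_assoc]
      congr 1
      rw [inv_mul_eq_iff_eq_mul₀ ht.1.ne', ← div_eq_mul_inv, eq_div_iff hst, this])).add
    (h4.congr_right (g₂ := fun p => (√p.2)⁻¹ * p.1.err) fun p => by ring)
  obtain ⟨c, hc⟩ := isBigO_principal.1 h5
  refine isBigO_pairFilter (2 * |c|) fun d t hd ht => ?_
  have hderiv := fun s (hs : s ∈ Ioo 0 d.T) => hd.fst.hasDerivAt_log_div hd.snd ha hα hs
  -- Integrating |c|·err/√s from t to s yields 2|c|·err(√s - √t), at most the stated bound; s then
  -- tends to T.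
  have key : ∀ᶠ s in 𝓝[<] d.T, |(d.η s - d.η' s) - (d.η t - d.η' t)| ≤
      2 * |c| * (√d.T * d.err) := by
    filter_upwards [Ioo_mem_nhdsLT ht.2] with s hs
    have hs' : s ∈ Ioo 0 d.T := ⟨ht.1.trans hs.1, hs.2⟩
    have h6 := norm_sub_le_of_norm_deriv_le (B := fun t => |c| * d.err * (2 * √t))
      (b := fun t => |c| * d.err * (√t)⁻¹) hderiv
      (fun s hs => (hasDerivAt_two_mul_sqrt hs.1).const_mul _) (fun s hs => ?_) ht.1 hs.1.le hs.2
    · have h7 := (Complex.abs_im_le_norm _).trans h6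
      rw [Complex.sub_im, Complex.log_im, Complex.log_im, hd.fst.arg_div hd.snd ha hα hs',
        hd.fst.arg_div hd.snd ha hα ht] at h7
      have h8 : √s ≤ √d.T := Real.sqrt_le_sqrt hs.2.le
      have h9 := mul_le_mul_of_nonneg_left h8 (mul_nonneg (abs_nonneg c) hd.err_nonneg)
      have h10 := mul_nonneg (mul_nonneg (abs_nonneg c) hd.err_nonneg) (Real.sqrt_nonneg t)
      linarith
    · have h7 := hc (d, s) ⟨hd, hs⟩
      rw [Real.norm_of_nonneg (mul_nonneg (inv_nonneg.2 (Real.sqrt_nonneg _)) hd.err_nonneg)] at h7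
      refine le_trans (le_of_eq ?_) (h7.trans ((mul_le_mul_of_nonneg_right (le_abs_self c)
        (mul_nonneg (inv_nonneg.2 (Real.sqrt_nonneg _)) hd.err_nonneg)).trans (le_of_eq ?_)))
      · congr 1
        simp only
        ring
      · simp only
        ring
  have hlim := ((hd.fst.angle.sub hd.snd.angle).sub_const (d.η t - d.η' t)).abs
  have : (𝓝[<] d.T).NeBot := inferInstance
  have := le_of_tendsto hlim key
  rw [sub_zero, zero_sub, abs_neg] at this
  exact this

end

/-! ### The contraction argument -/

/-- One step of the contraction argument, with a constant that is uniform in the pair. -/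
theorem exists_isPair_contract {ξ a b : ℝ} {α : Fin 3 → ℂ} (hα : IsSelfSimilar ξ a b α)
    (hξ : ξ ≠ 0) {r K : ℝ} (hK : IsRegularBall α r K) (B : ℝ) :
    ∃ C > 0, ∀ d, IsPair ξ a b α B r d →
      (∀ t ∈ Ioo 0 d.T, ∀ j, ‖d.z j t - d.z' j t‖ ≤ C * √d.T * d.err) ∧
      IsPair ξ a b α B r { d with N := C * √d.T * d.err } := by
  have ha := hα.pos
  have h0 := hα.ne_zero hξ
  have hd₀ := hα.distinct_shape hξ
  obtain ⟨c₁, h₁⟩ := isBigO_principal.1 (isBigO_relShape_sub (ξ := ξ) (b := b) (B := B) ha h0 hd₀ hK)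
  obtain ⟨c₂, h₂⟩ := isBigO_principal.1 (isBigO_radius_sub (ξ := ξ) (b := b) (B := B) ha h0 hd₀ hK)
  obtain ⟨c₃, h₃⟩ := isBigO_principal.1 (isBigO_angle_sub (ξ := ξ) (b := b) (B := B) ha h0 hd₀ hK)
  have h₄ := fun j => isBigO_principal.1
    (near_position (ξ := ξ) (b := b) (B := B) (r := r) ha h0 j).diff
  choose c₄ h₄ using h₄
  set C : ℝ := 1 + |c₁| + |c₂| + |c₃| + (|c₄ 0| + |c₄ 1| + |c₄ 2|) with hC
  have hC1 : c₁ ≤ C := by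
    have := le_abs_self c₁
    rw [hC]; linarith [abs_nonneg c₂, abs_nonneg c₃, abs_nonneg (c₄ 0), abs_nonneg (c₄ 1), abs_nonneg (c₄ 2)]
  have hC2 : c₂ ≤ C := by
    have := le_abs_self c₂
    rw [hC]; linarith [abs_nonneg c₁, abs_nonneg c₃, abs_nonneg (c₄ 0), abs_nonneg (c₄ 1), abs_nonneg (c₄ 2)]
  have hC3 : c₃ ≤ C := by
    have := le_abs_self c₃
    rw [hC]; linarith [abs_nonneg c₂, abs_nonneg c₁, abs_nonneg (c₄ 0), abs_nonneg (c₄ 1), abs_nonneg (c₄ 2)]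
  have hC4 : ∀ j, c₄ j ≤ C := fun j => by
    have hle := le_abs_self (c₄ j)
    have : |c₄ j| ≤ |c₄ 0| + |c₄ 1| + |c₄ 2| := by
      fin_cases j <;> simp only [Fin.zero_eta, Fin.mk_one, Fin.reduceFinMk] <;>
        linarith [abs_nonneg (c₄ 0), abs_nonneg (c₄ 1), abs_nonneg (c₄ 2)]
    rw [hC]; linarith [abs_nonneg c₁, abs_nonneg c₂, abs_nonneg c₃]
  have hC0 : 0 < C := by positivity
  refine ⟨C, hC0, fun d hd => ?_⟩
  have he := hd.err_nonneg
  have bound : ∀ {c x s : ℝ}, c ≤ C → 0 ≤ s → s ≤ √d.T → x ≤ c * ‖s * d.err‖ →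
      x ≤ C * √d.T * d.err := by
    intro c x s hc hs hsT hx
    rw [Real.norm_of_nonneg (mul_nonneg hs he)] at hx
    calc x ≤ c * (s * d.err) := hx
      _ ≤ C * (√d.T * d.err) := by gcongr
      _ = _ := by ring
  have hsq : ∀ t ∈ Ioo 0 d.T, √t ≤ √d.T := fun t ht => Real.sqrt_le_sqrt ht.2.le
  refine ⟨fun t ht j => bound (hC4 j) (Real.sqrt_nonneg t) (hsq t ht) (h₄ j (d, t) ⟨hd, ht⟩),
    { hd with
      nonneg_N := by simp only; positivity
      shape := fun t ht => bound hC1 (Real.sqrt_nonneg t) (hsq t ht) (h₁ (d, t) ⟨hd, ht⟩)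
      radius := fun t ht => ?_
      angle := fun t ht => bound hC3 (Real.sqrt_nonneg _) le_rfl (h₃ (d, t) ⟨hd, ht⟩) }⟩
  have h := h₂ (d, t) ⟨hd, ht⟩
  rw [Real.norm_of_nonneg (mul_nonneg (mul_nonneg ht.1.le (Real.sqrt_nonneg _)) he)] at h
  calc |d.ζ t - d.ζ' t| ≤ c₂ * (t * √t * d.err) := h
    _ ≤ C * (t * √d.T * d.err) := by
      have h1 := ht.1.le
      have h2 := hsq t ht
      gcongr
    _ = _ := by ring

/-- The distance of two bursts is bounded by the distance of the fields. -/
theorem exists_isPair_bound {ξ a b : ℝ} {α : Fin 3 → ℂ} (hα : IsSelfSimilar ξ a b α)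
    (hξ : ξ ≠ 0) {r K : ℝ} (hK : IsRegularBall α r K) (B : ℝ) :
    ∃ C > 0, ∀ d, IsPair ξ a b α B r d → C * √d.T ≤ 1 →
      ∀ t ∈ Ioo 0 d.T, (∀ j, ‖d.z j t - d.z' j t‖ ≤ C * √d.T * d.D) ∧
        ‖relShape d.z t - relShape d.z' t‖ ≤ C * √d.T * d.D := by
  obtain ⟨C, hC, h⟩ := exists_isPair_contract hα hξ hK B
  -- With the doubled constant, the smallness hypothesis reads C√T ≤ 1/2, so the term C√T N is
  -- absorbed.
  refine ⟨2 * C, by positivity, fun d hd hT => ?_⟩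
  -- All conditions on N are closed lower bounds, so the infimum of the admissible N is itself
  -- admissible. One contraction step at this minimum replaces an iteration.
  set S : Set ℝ := {N | IsPair ξ a b α B r { d with N := N }} with hS
  have hne : S.Nonempty := ⟨d.N, hd⟩
  have hmin : IsPair ξ a b α B r { d with N := sInf S } :=
    { hd with
      nonneg_N := le_csInf hne fun N hN => hN.nonneg_N
      shape := fun t ht => le_csInf hne fun N hN => hN.shape t ht
      radius := fun t ht => by
        have : |d.ζ t - d.ζ' t| / t ≤ sInf S := le_csInf hne fun N hN => by
          rw [div_le_iff₀ ht.1]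
          exact hN.radius t ht
        rwa [div_le_iff₀ ht.1] at this
      angle := fun t ht => le_csInf hne fun N hN => hN.angle t ht }
  obtain ⟨hz, hmin'⟩ := h _ hmin
  have hbdd : BddBelow S := ⟨0, fun N hN => hN.nonneg_N⟩
  have hle : sInf S ≤ C * √d.T * (sInf S + d.D) := csInf_le hbdd hmin'
  have hN0 : 0 ≤ sInf S := hmin.nonneg_N
  have hD := hd.nonneg_D
  have hN : sInf S ≤ 2 * C * √d.T * d.D := by nlinarith
  have hND : sInf S ≤ d.D := hN.trans (by nlinarith)
  refine fun t ht => ⟨fun j => (hz t ht j).trans ?_, (hmin.shape t ht).trans hN⟩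
  have h1 : 0 ≤ C * √d.T := by positivity
  calc C * √d.T * (sInf S + d.D) ≤ C * √d.T * (d.D + d.D) := by gcongr
    _ = _ := by ring

/-! ### From bursting solutions to perturbed bursts -/

/-- A bounded field that is Lipschitz in space. -/
structure IsLipschitzField (M T : ℝ) (f : ℝ → ℂ → ℂ) : Prop where
  norm_le : ∀ t ∈ Ico 0 T, ∀ p, ‖f t p‖ ≤ M
  norm_sub_le : ∀ t ∈ Ico 0 T, ∀ p q, ‖f t p - f t q‖ ≤ M * ‖p - q‖

theorem isLipschitzField_of_eNorm_le {M T : ℝ} {f : ℝ → ℂ → ℂ} (hf : MemE T f) (hM : 0 ≤ M)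
    (h : eNorm T f ≤ ENNReal.ofReal M) : IsLipschitzField M T f := by
  have key : ∀ t ∈ Ico 0 T, ∀ k ∈ Finset.range 3, ∀ p, ‖iteratedFDeriv ℝ k (f t) p‖ ≤ M := by
    intro t ht k hk p
    have h1 : c2Norm (f t) ≤ ENNReal.ofReal M :=
      ((le_iSup₂ (f := fun t (_ : t ∈ Ico 0 T) => c2Norm (f t)) t ht).trans le_self_add).trans h
    have h2 : ‖iteratedFDeriv ℝ k (f t) p‖ₑ ≤ ENNReal.ofReal M :=
      ((le_iSup (fun p => ‖iteratedFDeriv ℝ k (f t) p‖ₑ) p).trans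
        (Finset.single_le_sum_of_canonicallyOrdered
          (f := fun k => ⨆ p : ℂ, ‖iteratedFDeriv ℝ k (f t) p‖ₑ) hk)).trans h1
    rwa [← ofReal_norm, ENNReal.ofReal_le_ofReal_iff hM] at h2
  refine ⟨fun t ht p => ?_, fun t ht p q => ?_⟩
  · simpa using key t ht 0 (by simp) p
  · have hd := (hf.contDiff t ht).differentiable (by norm_num)
    refine convex_univ.norm_image_sub_le_of_norm_fderiv_le (𝕜 := ℝ) (fun x _ => hd x)
      (fun x _ => ?_) (mem_univ q) (mem_univ p)
    rw [← norm_iteratedFDeriv_one]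
    exact key t ht 1 (by simp) x

theorem norm_sub_le_supDist {M T : ℝ} {f g : ℝ → ℂ → ℂ} (hf : IsLipschitzField M T f)
    (hg : IsLipschitzField M T g) : supDist T f g ≠ ⊤ ∧
      ∀ t ∈ Ico 0 T, ∀ p, ‖f t p - g t p‖ ≤ (supDist T f g).toReal := by
  have hfin : supDist T f g ≤ ENNReal.ofReal (M + M) := by
    refine iSup₂_le fun t ht => iSup_le fun p => ?_
    rw [← ofReal_norm]
    exact ENNReal.ofReal_le_ofReal
      ((norm_sub_le _ _).trans (add_le_add (hf.norm_le t ht p) (hg.norm_le t ht p)))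
  have htop := ne_top_of_le_ne_top ENNReal.ofReal_ne_top hfin
  refine ⟨htop, fun t ht p => ?_⟩
  rw [← toReal_enorm]
  refine ENNReal.toReal_mono htop ?_
  exact (le_iSup (fun p => ‖f t p - g t p‖ₑ) p).trans
    (le_iSup₂ (f := fun t (_ : t ∈ Ico 0 T) => ⨆ p : ℂ, ‖f t p - g t p‖ₑ) t ht)

/-- Removing the drift conj(f(0,0)) t leaves the mutual distances unchanged and turns the force into
f(t, z_j) - f(0,0), bounded by 2M. The Hölder bound on η and its limit 0 at T give |η| ≤ √T. -/
theorem IsBurst.exists_perturbedBurst {ξ a b ρ T M : ℝ} {α : Fin 3 → ℂ} {f : ℝ → ℂ → ℂ}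
    {z : ℝ → C3} (h : IsBurst ξ a b α ρ T f z) (ha : 0 < a) (hα : α 0 ≠ 0)
    (hf : IsLipschitzField M T f) (hT : √T ≤ a) (hT1 : T ≤ 1) {B : ℝ} (hB : 2 * M ≤ B) :
    ∃ ζ η, PerturbedBurst ξ a b α B T (fun j t => comoving f z t j)
      (fun j t => f t (z t j) - f 0 0) ζ η := by
  obtain ⟨ζ, η, x₂, x₃, hU, hx⟩ := h.mem
  have hpolar : ∀ t ∈ Ioo 0 T, comoving f z t 0 = α 0 * (√(ζ t) *
      Complex.exp (((η t + b / (2 * a) * Real.log t : ℝ) : ℂ) * Complex.I)) := by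
    intro t ht
    have := congrArg (fun x : C3 => x 0) (hx t ht)
    simp only [Φ, PiLp.toLp_apply, Matrix.cons_val] at this
    rw [← this, mul_div_cancel₀ _ hα]
  have hradius : ∀ t ∈ Ioo 0 T, |ζ t - 2 * a * t| ≤ t * √t := by
    intro t ht
    refine (hU.dist_radius t ht).trans (le_of_eq ?_)
    rw [Real.sqrt_eq_rpow, show (3 / 2 : ℝ) = 1 + 1 / 2 by norm_num, Real.rpow_add ht.1,
      Real.rpow_one]
  have hne : ∀ t ∈ Ioo 0 T, comoving f z t 0 ≠ 0 := by
    intro t ht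
    have h1 : √t ≤ a := (Real.sqrt_le_sqrt ht.2.le).trans hT
    have h2 := (abs_le.1 (hradius t ht)).1
    have h3 : 0 < ζ t := by
      nlinarith [mul_le_mul_of_nonneg_left h1 ht.1.le, mul_pos ha ht.1]
    rw [hpolar t ht]
    refine mul_ne_zero hα (mul_ne_zero ?_ (Complex.exp_ne_zero _))
    exact Complex.ofReal_ne_zero.2 (Real.sqrt_pos.2 h3).ne'
  have hsub : ∀ t j k, comoving f z t j - comoving f z t k = z t j - z t k := fun t j k => by
    simp [comoving]
  have hinj : ∀ t ∈ Ioo 0 T, Function.Injective fun j => comoving f z t j := by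
    intro t ht j k hjk
    by_contra hne
    refine h.solution.noCollision t ht j k hne (sub_eq_zero.1 ?_)
    rw [← hsub, sub_eq_zero]
    exact hjk
  have hholder : ∀ s ∈ Ioo 0 T, ∀ t ∈ Ioo 0 T, |η t - η s| ≤ √T := by
    intro s hs t ht
    have h1 := hU.holder.2.1.dist_le ht hs
    rw [Real.dist_eq, Real.dist_eq] at h1
    refine h1.trans ?_
    rw [NNReal.coe_one, one_mul]
    push_cast
    rw [← Real.sqrt_eq_rpow]
    refine Real.sqrt_le_sqrt (abs_le.2 ⟨?_, ?_⟩) <;> linarith [hs.1, hs.2, ht.1, ht.2]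
  refine ⟨ζ, η, hT, hT1, fun t ht => ?_, fun t ht j => ?_, fun t ht j => ?_, hpolar, hradius,
    fun t ht => ?_, fun t ht => ?_, hU.angle⟩
  · have hz := hne t ht
    have hi := hinj t ht
    refine ⟨?_, ?_, ?_⟩ <;> simp only [relShape]
    · rw [one_sub_div hz]
      exact div_ne_zero (sub_ne_zero.2 (hi.ne (by decide : (0 : Fin 3) ≠ 1))) hz
    · rw [one_sub_div hz]
      exact div_ne_zero (sub_ne_zero.2 (hi.ne (by decide : (0 : Fin 3) ≠ 2))) hz
    · rw [← sub_div]
      exact div_ne_zero (sub_ne_zero.2 (hi.ne (by decide : (1 : Fin 3) ≠ 2))) hz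
  · have h1 := (h.solution.equation t ht j).star
    have h2 : HasDerivAt (fun s : ℝ => conj (f 0 0) * (s : ℂ)) (conj (f 0 0)) t := by
      simpa using (Complex.ofRealCLM.hasDerivAt (x := t)).const_mul (conj (f 0 0))
    have h3 := h1.sub h2
    have h4 := velocity_eq_kap ξ (hinj t ht) (hne t ht) j
    simp only [hsub] at h4
    rw [h4] at h3
    refine (h3.congr_of_eventuallyEq (.of_forall fun s => ?_)).congr_deriv ?_
    · simp [comoving]
    · simp only [relShape, ← starRingEnd_apply, map_add, map_sub]
      ring
  · have h0 : (0 : ℝ) ∈ Ico 0 T := ⟨le_rfl, ht.1.trans ht.2⟩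
    refine (norm_sub_le _ _).trans (le_trans ?_ hB)
    linarith [hf.norm_le t ⟨ht.1.le, ht.2⟩ (z t j), hf.norm_le 0 h0 0]
  · have h2 := congrArg (fun x : C3 => x 1) (hx t ht)
    have h3 := congrArg (fun x : C3 => x 2) (hx t ht)
    simp only [Φ, PiLp.toLp_apply, Matrix.cons_val] at h2 h3
    rw [Real.sqrt_eq_rpow]
    refine norm_prod_le_iff.2 ⟨?_, ?_⟩
    · simp only [relShape, VortexBurst.shape, Prod.fst_sub]
      rw [h2]
      exact (hU.dist_shape t ht).1
    · simp only [relShape, VortexBurst.shape, Prod.snd_sub]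
      rw [h3]
      exact (hU.dist_shape t ht).2
  · have h1 : Tendsto (fun s => |η t - η s|) (𝓝[<] T) (𝓝 |η t - 0|) :=
      (tendsto_const_nhds.sub hU.angle).abs
    rw [sub_zero] at h1
    refine le_of_tendsto h1 ?_
    filter_upwards [Ioo_mem_nhdsLT (ht.1.trans ht.2)] with s hs using hholder s hs t ht

theorem norm_C3_le (x : C3) : ‖x‖ ≤ ‖x 0‖ + ‖x 1‖ + ‖x 2‖ := by
  rw [EuclideanSpace.norm_eq, Fin.sum_univ_three]
  refine Real.sqrt_le_iff.2 ⟨by positivity, ?_⟩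
  nlinarith [mul_nonneg (norm_nonneg (x 0)) (norm_nonneg (x 1)),
    mul_nonneg (norm_nonneg (x 0)) (norm_nonneg (x 2)),
    mul_nonneg (norm_nonneg (x 1)) (norm_nonneg (x 2))]

/-- Two bursts on a short interval depend on the field in a Lipschitz way. -/
theorem exists_burst_bound {ξ a b : ℝ} {α : Fin 3 → ℂ} (hα : IsSelfSimilar ξ a b α)
    (hξ : ξ ≠ 0) {M : ℝ} (hM : 0 < M) : ∃ C > 0, ∃ Tstar > 0, ∀ T, 0 < T → T < Tstar →
      ∀ f g : ℝ → ℂ → ℂ, IsLipschitzField M T f → IsLipschitzField M T g → ∀ ρ, ∀ z z' : ℝ → C3,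
        IsBurst ξ a b α ρ T f z → IsBurst ξ a b α ρ T g z' → ∀ t ∈ Ioo 0 T,
          (∀ j, ‖z t j - z' t j‖ ≤ C * √T * (supDist T f g).toReal) ∧
          ‖Φ α (comoving f z t) - Φ α (comoving g z' t)‖ ≤ C * √T * (supDist T f g).toReal := by
  have ha := hα.pos
  have h0 := hα.ne_zero hξ
  obtain ⟨r, K, hK⟩ := exists_isRegularBall hα hξ
  obtain ⟨C, hC, hbound⟩ := exists_isPair_bound hα hξ hK (2 * M + 2)
  set τ : ℝ := min (min 1 a) (min r (1 / C)) with hτ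
  have hτ0 : 0 < τ := lt_min (lt_min one_pos ha) (lt_min hK.pos (by positivity))
  -- The 1 pays for the drift difference D t ≤ D√T in the positions; the bracket is the sum of the
  -- bounds for the three coordinates of Φ.
  refine ⟨C + 1 + (C / ‖α 0‖ + C + C), by positivity, τ ^ 2, by positivity, ?_⟩
  intro T hT hTτ f g hf hg ρ z z' hz hz' t ht
  have hs : √T ≤ τ := ((Real.sqrt_lt' hτ0).2 hTτ).le
  have hs1 : √T ≤ 1 := hs.trans ((min_le_left _ _).trans (min_le_left _ _))
  have hsa : √T ≤ a := hs.trans ((min_le_left _ _).trans (min_le_right _ _))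
  have hsr : √T ≤ r := hs.trans ((min_le_right _ _).trans (min_le_left _ _))
  have hsC : C * √T ≤ 1 := by
    have := hs.trans ((min_le_right _ _).trans (min_le_right _ _))
    rwa [le_div_iff₀ hC, mul_comm] at this
  have hT1 : T ≤ 1 := Real.sqrt_le_one.1 hs1
  obtain ⟨ζ, η, hp⟩ := hz.exists_perturbedBurst ha h0 hf hsa hT1 (B := 2 * M + 2) (by linarith)
  obtain ⟨ζ', η', hp'⟩ := hz'.exists_perturbedBurst ha h0 hg hsa hT1 (B := 2 * M + 2) (by linarith)
  obtain ⟨-, hD⟩ := norm_sub_le_supDist hf hg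
  set D := (supDist T f g).toReal with hDdef
  have hD0 : 0 ≤ D := ENNReal.toReal_nonneg
  have hzero : ‖f 0 0 - g 0 0‖ ≤ D := hD 0 ⟨le_rfl, hT⟩ 0
  have hdiff : ∀ t ∈ Ioo 0 T, ∀ j,
      ‖z t j - z' t j‖ ≤ ‖comoving f z t j - comoving g z' t j‖ + D * t := by
    intro t ht j
    have : z t j - z' t j = (comoving f z t j - comoving g z' t j) +
        conj (f 0 0 - g 0 0) * t := by
      simp [comoving]
      ring
    rw [this]
    refine (norm_add_le _ _).trans (add_le_add le_rfl ?_)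
    rw [norm_mul, RCLike.norm_conj, Complex.norm_real, Real.norm_of_nonneg ht.1.le]
    exact mul_le_mul_of_nonneg_right hzero ht.1.le
  -- N = 2 is admissible because each burst lies within √t, t√t and √T of the model in shape,
  -- squared radius and angle. The force constant 2M + 2 dominates M + 2, the factor of D: one D
  -- from the fields, one from their values at (0,0), and M D from the drift inside the Lipschitz
  -- term.
  have hpair : IsPair ξ a b α (2 * M + 2) r
      { T := T, N := 2, D := D,
        z := fun j t => comoving f z t j, φ := fun j t => f t (z t j) - f 0 0,
        z' := fun j t => comoving g z' t j, φ' := fun j t => g t (z' t j) - g 0 0,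
        ζ := ζ, η := η, ζ' := ζ', η' := η' } := by
    refine ⟨hp, hp', hsr, zero_le_two, hD0, fun t ht => ?_, fun t ht => ?_, fun t ht => ?_,
      fun t ht j => ?_⟩
    · have h1 := hp.shape t ht
      have h2 := hp'.shape t ht
      have h3 : √t ≤ 1 := (Real.sqrt_le_sqrt ht.2.le).trans hs1
      rw [norm_sub_rev] at h2
      exact (norm_sub_le_norm_sub_add_norm_sub _ _ _).trans (by linarith)
    · have h1 := hp.radius t ht
      have h2 := hp'.radius t ht
      have h3 : √t ≤ 1 := (Real.sqrt_le_sqrt ht.2.le).trans hs1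
      rw [abs_sub_comm] at h2
      refine (abs_sub_le _ (2 * a * t) _).trans ?_
      simp only
      nlinarith [mul_le_mul_of_nonneg_left h3 ht.1.le]
    · have h1 := hp.angle_le t ht
      have h2 := hp'.angle_le t ht
      exact (abs_sub _ _).trans (by simp only; linarith)
    · simp only
      have htI : t ∈ Ico 0 T := ⟨ht.1.le, ht.2⟩
      have h1 := hD t htI (z t j)
      have h2 := hg.norm_sub_le t htI (z t j) (z' t j)
      have h3 := hdiff t ht j
      have h4 : t ≤ 1 := ht.2.le.trans hT1
      have h5 : f t (z t j) - f 0 0 - (g t (z' t j) - g 0 0) =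
          (f t (z t j) - g t (z t j)) + (g t (z t j) - g t (z' t j)) - (f 0 0 - g 0 0) := by ring
      rw [h5]
      refine (norm_sub_le _ _).trans ((add_le_add (norm_add_le _ _) le_rfl).trans ?_)
      have h6 : D * t ≤ D := mul_le_of_le_one_right hD0 h4
      have h7 := mul_le_mul_of_nonneg_left (h3.trans (add_le_add le_rfl h6)) hM.le
      have h8 := mul_nonneg hM.le (norm_nonneg (comoving f z t j - comoving g z' t j))
      have h9 := mul_nonneg hM.le hD0
      have h10 := norm_nonneg (comoving f z t j - comoving g z' t j)
      nlinarith
  obtain ⟨hpos, hshape⟩ := hbound _ hpair hsC t ht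
  simp only at hpos hshape
  have hA : 0 < ‖α 0‖ := norm_pos_iff.2 h0
  have hsD : 0 ≤ √T * D := by positivity
  refine ⟨fun j => ?_, ?_⟩
  · have h1 := hdiff t ht j
    have h2 : t ≤ √T := by
      have := Real.mul_self_sqrt hT.le
      nlinarith [Real.sqrt_nonneg T, ht.2]
    have h3 := mul_le_mul_of_nonneg_left h2 hD0
    have h4 : 0 ≤ (C / ‖α 0‖ + C + C) * (√T * D) := by positivity
    linarith [hpos j]
  · refine (norm_C3_le _).trans ?_
    have e0 : ‖(Φ α (comoving f z t) - Φ α (comoving g z' t)) 0‖ ≤ C / ‖α 0‖ * (√T * D) := by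
      simp only [Φ, PiLp.sub_apply, Matrix.cons_val]
      rw [← sub_div, norm_div, div_le_iff₀ hA]
      refine (hpos 0).trans (le_of_eq ?_)
      field_simp
    have e1 : ‖(Φ α (comoving f z t) - Φ α (comoving g z' t)) 1‖ ≤ C * (√T * D) := by
      simp only [Φ, PiLp.sub_apply, Matrix.cons_val, sub_sub_sub_cancel_right]
      have := (norm_fst_le _).trans hshape
      simp only [relShape, Prod.fst_sub] at this
      linarith
    have e2 : ‖(Φ α (comoving f z t) - Φ α (comoving g z' t)) 2‖ ≤ C * (√T * D) := by
      simp only [Φ, PiLp.sub_apply, Matrix.cons_val, sub_sub_sub_cancel_right]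
      have := (norm_snd_le _).trans hshape
      simp only [relShape, Prod.snd_sub] at this
      linarith
    have h4 : 0 ≤ (C + 1) * (√T * D) := by positivity
    linarith

end VortexBurst

theorem mainTheorem3 (ξ a b : ℝ) (α : Fin 3 → ℂ) (hξ : ξ ≠ 0)
    (hα : VortexBurst.IsSelfSimilar ξ a b α) (M : ℝ) (hM : 0 < M) :
    ∃ C : ℝ, 0 < C ∧ ∀ ρ : ℝ, 0 < ρ → ∃ Tstar : ℝ, 0 < Tstar ∧
      ∀ T : ℝ, 0 < T → T < Tstar → ∀ f g : ℝ → ℂ → ℂ,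
        VortexBurst.MemE T f → VortexBurst.MemE T g →
        VortexBurst.eNorm T f ≤ ENNReal.ofReal M → VortexBurst.eNorm T g ≤ ENNReal.ofReal M →
        ∀ z z' : ℝ → VortexBurst.C3,
          VortexBurst.IsBurst ξ a b α ρ T f z → VortexBurst.IsBurst ξ a b α ρ T g z' →
          (⨆ t ∈ Set.Ioo 0 T, ⨆ j : Fin 3, ‖z t j - z' t j‖ₑ) ≤
              ENNReal.ofReal (C * T ^ (1 / 2 : ℝ)) * VortexBurst.supDist T f g ∧
          (⨆ t ∈ Set.Ioo 0 T,
              ‖VortexBurst.Φ α (VortexBurst.comoving f z t) -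
                VortexBurst.Φ α (VortexBurst.comoving g z' t)‖ₑ) ≤
              ENNReal.ofReal (C * T ^ (1 / 2 : ℝ)) * VortexBurst.supDist T f g := by
  obtain ⟨C, hC, Tstar, hTstar, h⟩ := VortexBurst.exists_burst_bound hα hξ hM
  refine ⟨C, hC, fun ρ _ => ⟨Tstar, hTstar, fun T hT hTs f g hf hg hfM hgM z z' hz hz' => ?_⟩⟩
  have hf' := VortexBurst.isLipschitzField_of_eNorm_le hf hM.le hfM
  have hg' := VortexBurst.isLipschitzField_of_eNorm_le hg hM.le hgM
  have key := h T hT hTs f g hf' hg' ρ z z' hz hz'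
  -- The distance of the fields is finite, so the extended-real inequalities reduce to pointwise
  -- real ones.
  rw [← ENNReal.ofReal_toReal (VortexBurst.norm_sub_le_supDist hf' hg').1,
    ← ENNReal.ofReal_mul (by positivity), ← Real.sqrt_eq_rpow]
  refine ⟨iSup₂_le fun t ht => iSup_le fun j => ?_, iSup₂_le fun t ht => ?_⟩ <;>
    rw [← ofReal_norm]
  · exact ENNReal.ofReal_le_ofReal ((key t ht).1 j)
  · exact ENNReal.ofReal_le_ofReal (key t ht).2
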